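/- Fix $p\in(0,1)$, put $q=1-p$ and $(q;q)_\infty=\prod_{r\ge1}(1-q^r)$. In the careless coupon collector with $n\ge1$ coupon types, let $S_t\subseteq[n]$ be the set of types held after round $t$, with $S_0=\emptyset$ and $$S_{t+1}=(S_t\cup\{J_t\})\setminus\{i:L_{i,t}=1\},$$ where all the $J_t$ and $L_{i,t}$ are independent, $J_t$ is uniform on $[n]$, and $\mathbb P(L_{i,t}=1)=p$, $\mathbb P(L_{i,t}=0)=q$. Let $T_{n,p}=\inf\{t\ge0:S_t=[n]\}$ be the post-loss completion time. The count $K_t=|S_t|$ is the Markov chain on $\{0,\dots,n\}$ which from $k$ moves to a $\mathrm{Bin}(k,q)$ variable with probability $k/n$ and to a $\mathrm{Bin}(k+1,q)$ variable with probability $(n-k)/n$. This chain has a unique stationary law $\nu_n$. Let $\mu_n=\mathbb P_{\nu_n}(K_0<n,\,K_1=n)$ be the stationary-entry flux into completion, and let $Y_n=\mu_nT_{n,p}$. Then there are constants $C,c\in(0,\infty)$ depending only on $p$ such that, for all sufficiently large $n$, $$\mathbb P(Y_n>x)\le Ce^{-cx}\qquad\text{for all }x\ge0.$$ Consequently, for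 all sufficiently large $n$, $T_{n,p}$ is almost surely finite and has finite moments of all orders, and for every fixed integer $r\ge1$, $$\mathbb E\,Y_n^r\longrightarrow r!\qquad(n\to\infty).$$ In particular, as $n\to\infty$, $$\mathbb E\,T_{n,p}\sim\frac1{\mu_n},\qquad \mathrm{Var}(T_{n,p})\sim\frac1{\mu_n^2}.$$ Moreover $$\mu_n\sim\frac1{(q;q)_\infty}\frac{n!}{n^n}\,q^{n(n+1)/2},$$ and hence $$\mathbb E\,T_{n,p}\sim(q;q)_\infty\frac{n^n}{n!}\,q^{-n(n+1)/2},\qquad \mathrm{Var}(T_{n,p})\sim(q;q)_\infty^2\Bigl(\frac{n^n}{n!}\Bigr)^2q^{-n(n+1)}.$$ -/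

import Mathlib

open MeasureTheory ProbabilityTheory Filter Asymptotics Topology

noncomputable section

namespace CarelessCollector

/-- The driving randomness for `n` coupon types: at each round `t`, the type `(ω t).1` drawn in that
round and the loss indicators `(ω t).2 i` of all types `i` (`true` means that a held copy of `i`
is lost). -/
abbrev Drive (n : ℕ) : Type := ℕ → Fin n × (Fin n → Bool)

/-- The law of the driving randomness (for `n ≥ 1`): rounds are i.i.d.; in each round the drawn type
is uniform, the loss indicators are independent Bernoulli(`p`), and draw and losses are
independent. -/
def driveLaw (p : unitInterval) (n : ℕ) : Measure (Drive n) :=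
  Measure.infinitePi fun _ : ℕ =>
    (uniformOn (Set.univ : Set (Fin n))).prod
      (Measure.pi fun _ : Fin n => bernoulliMeasure true false p)

/-- The set of types held after the loss step of round `t`, started from the empty collection:
`S₀ = ∅` and `S_{t+1} = (S_t ∪ {J_t}) \ {i : L_{i,t} = 1}`. -/
def held {n : ℕ} : ℕ → Drive n → Finset (Fin n)
  | 0, _ => ∅
  | t + 1, ω => (insert (ω t).1 (held t ω)).filter fun i => (ω t).2 i = false

/-- The post-loss completion time `inf {t ≥ 0 : S_t = [n]}`, equal to `⊤` if completion never
happens. -/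
def completionTime (n : ℕ) (ω : Drive n) : ℕ∞ :=
  hittingAfter (held (n := n)) {Finset.univ} 0 ω

/-- The completion time as a real number (with value `0` on the event that it is infinite). -/
def completionTimeReal (n : ℕ) (ω : Drive n) : ℝ := ((completionTime n ω).toNat : ℝ)

/-- The probability that a Bin(`m`, `q`) variable equals `j`. -/
def binomialProb (q : ℝ) (m j : ℕ) : ℝ := (m.choose j : ℝ) * q ^ j * (1 - q) ^ (m - j)

/-- The transition matrix of the number of held types on `{0, …, n}` (for `n ≥ 1`): from `k`, the
next state is Bin(`k`, `q`) with probability `k / n` and Bin(`k + 1`, `q`) with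
probability `(n - k) / n`. -/
def countTransition (q : ℝ) (n : ℕ) : Matrix (Fin (n + 1)) (Fin (n + 1)) ℝ :=
  Matrix.of fun k j =>
    ((k : ℕ) : ℝ) / n * binomialProb q k j
      + ((n : ℝ) - ((k : ℕ) : ℝ)) / n * binomialProb q (k + 1) j

/-- `ν` is a stationary probability law of the count chain. -/
def IsStationaryLaw (q : ℝ) (n : ℕ) (ν : Fin (n + 1) → ℝ) : Prop :=
  ν ∈ stdSimplex ℝ (Fin (n + 1)) ∧ Matrix.vecMul ν (countTransition q n) = ν

/-- The flux into completion, `P_ν(K₀ < n, K₁ = n)`, for the count chain `K` with initial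
law `ν`. -/
def entryFlux (q : ℝ) (n : ℕ) (ν : Fin (n + 1) → ℝ) : ℝ :=
  ∑ k ∈ Finset.Iio (Fin.last n), ν k * countTransition q n k (Fin.last n)

/-- The infinite product `(q; q)_∞ = ∏_{r ≥ 1} (1 - q ^ r)`. -/
def qPoch (q : ℝ) : ℝ := ∏' r : ℕ, (1 - q ^ (r + 1))

end CarelessCollector

end

/-! Completion is a rare event for a chain that forgets its start quickly, so its time `T` is nearly
geometric with rate `a = ν(n)`, the stationary mass of the full collection. Let `u_t` and `r_t` be
the probabilities of being full at time `t` from the empty and from the full collection, and `h_t =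
P(T = t)`. The renewal equation `u = h * r` rearranges to `a P(T ≥ t) = h_t + ∑_{s<t} h_s (r_{t-s} -
a) + (a - u_t)`.

Copies of the collection driven by the same draws and losses control the errors. Inclusion is
preserved, so `u_t ≤ a ≤ r_t` and the errors are nonnegative. A type on which two copies differ has
never been lost, so the errors are at most `n q^t`. Ending a round full requires `n` types to
survive it, so they are also at most `q^n` (for `r_t`, when `t ≥ 1`). The geometric mean of the two
bounds is `b ρ^t` with `b = √(n q^n) → 0` and `ρ = √q` fixed; this is `NearGeometric`.

The resulting inequality is then summed against submultiplicative weights. The weights `(1 + a/2)^t`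
give exponential tails (`tail_mul_pow_le`). The weights `C(t+k, k)` give `M_k ≤ a M_{k+1} ≤ M_k (1 +
bW) + bW` for `M_k = E C(T+k, k)`, hence `a^k M_k → 1`; since `k! C(t+k, k)` is `t^k` plus lower
order terms, `a^r E T^r → r!`.

The rate is explicit: the binomial moments `E_ν C(K, m)` obey a first-order recursion in `m`, and
the one with `m = n` is `a` (`IsStationaryLaw.last_eq`). Its denominator tends to `(q;q)_∞`, and
balance at the full state gives `μ_n = a (1 - q^n) ∼ a`. -/

noncomputable section

namespace CarelessCollector

/-! ### One round of the collector and the law of the count -/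

variable {n : ℕ}

/-- The held set after one round, started from `A`, with drawn type and loss indicators `x`. -/
def step (A : Finset (Fin n)) (x : Fin n × (Fin n → Bool)) : Finset (Fin n) :=
  (insert x.1 A).filter fun i => x.2 i = false

/-- The set of types held after `t` rounds, started from the collection `A`. -/
def heldFrom (A : Finset (Fin n)) : ℕ → Drive n → Finset (Fin n)
  | 0, _ => A
  | t + 1, ω => step (heldFrom A t ω) (ω t)

theorem held_eq_heldFrom (t : ℕ) (ω : Drive n) : held t ω = heldFrom ∅ t ω := by
  induction t with
  | zero => rfl
  | succ t ih => simp only [held, heldFrom, step, ih]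

/-- The law of the loss indicators in one round. -/
abbrev lossLaw (p : unitInterval) (n : ℕ) : Measure (Fin n → Bool) :=
  Measure.pi fun _ : Fin n => bernoulliMeasure true false p

/-- The law of the draw and the losses in one round. -/
abbrev roundLaw (p : unitInterval) (n : ℕ) : Measure (Fin n × (Fin n → Bool)) :=
  (uniformOn (Set.univ : Set (Fin n))).prod (lossLaw p n)

instance [NeZero n] : IsProbabilityMeasure (uniformOn (Set.univ : Set (Fin n))) :=
  isProbabilityMeasure_uniformOn Set.finite_univ ⟨0, trivial⟩

instance (p : unitInterval) [NeZero n] : IsProbabilityMeasure (driveLaw p n) := by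
  unfold driveLaw; infer_instance

theorem lossLaw_real_filter_eq (p : unitInterval) {C D : Finset (Fin n)} (h : D ⊆ C) :
    (lossLaw p n).real {L | C.filter (fun i => L i = false) = D}
      = (1 - (p : ℝ)) ^ D.card * (p : ℝ) ^ (C.card - D.card) := by
  -- A product set: types in `D` survive, types in `C \ D` are lost, the others are unconstrained.
  have hset : {L : Fin n → Bool | C.filter (fun i => L i = false) = D}
      = Set.pi Set.univ fun i => if i ∈ D then {false} else if i ∈ C then {true} else Set.univ := by
    ext L
    simp only [Set.mem_ofPred_eq, Finset.ext_iff, Finset.mem_filter, Set.mem_pi, Set.mem_univ,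
      forall_const]
    refine forall_congr' fun i => ?_
    have := @h i
    by_cases hD : i ∈ D <;> by_cases hC : i ∈ C <;> simp_all
  rw [hset, measureReal_def, Measure.pi_pi, ENNReal.toReal_prod]
  have hfac : ∀ i : Fin n, ((bernoulliMeasure true false p)
      (if i ∈ D then {false} else if i ∈ C then {true} else Set.univ)).toReal
      = (if i ∈ D then 1 - (p : ℝ) else 1) * (if i ∈ C \ D then (p : ℝ) else 1) := by
    intro i
    by_cases hD : i ∈ D <;> by_cases hC : i ∈ C <;>
      simp [hD, hC]
  simp only [hfac, Finset.prod_mul_distrib, Finset.prod_ite_mem, Finset.univ_inter,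
    Finset.prod_const, Finset.card_sdiff_of_subset h]

theorem lossLaw_real_card_filter (p : unitInterval) (C : Finset (Fin n)) (j : ℕ) :
    (lossLaw p n).real {L | (C.filter (fun i => L i = false)).card = j}
      = binomialProb (1 - (p : ℝ)) C.card j := by
  have hset : {L : Fin n → Bool | (C.filter (fun i => L i = false)).card = j}
      = ⋃ D ∈ C.powersetCard j, {L | C.filter (fun i => L i = false) = D} := by
    ext L
    simp [Finset.mem_powersetCard, Finset.filter_subset]
  rw [hset, measureReal_biUnion_finset]
  · rw [Finset.sum_congr rfl (fun D hD => by
      rw [lossLaw_real_filter_eq p (Finset.mem_powersetCard.1 hD).1,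
        (Finset.mem_powersetCard.1 hD).2])]
    simp [binomialProb, mul_assoc]
  · intro D _ D' _ hne
    refine Set.disjoint_left.2 fun L h1 h2 => hne ?_
    exact h1.symm.trans h2
  · intro D _
    exact (Set.toFinite _).measurableSet

theorem roundLaw_real_card_step (p : unitInterval) [NeZero n] (A : Finset (Fin n)) (j : ℕ) :
    (roundLaw p n).real {x | (step A x).card = j}
      = (A.card : ℝ) / n * binomialProb (1 - (p : ℝ)) A.card j
        + ((n : ℝ) - A.card) / n * binomialProb (1 - (p : ℝ)) (A.card + 1) j := by
  have hset : {x : Fin n × (Fin n → Bool) | (step A x).card = j}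
      = ⋃ i ∈ (Finset.univ : Finset (Fin n)),
        {i} ×ˢ {L | ((insert i A).filter (fun i => L i = false)).card = j} := by
    ext ⟨i, L⟩
    simp [step]
  rw [hset, measureReal_biUnion_finset]
  · have hi : ∀ i : Fin n, (roundLaw p n).real
        ({i} ×ˢ {L | ((insert i A).filter (fun i => L i = false)).card = j})
        = 1 / n * (if i ∈ A then binomialProb (1 - (p : ℝ)) A.card j
          else binomialProb (1 - (p : ℝ)) (A.card + 1) j) := by
      intro i
      rw [measureReal_prod_prod, lossLaw_real_card_filter]
      congr 1
      · simp [measureReal_def, uniformOn_univ]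
      · by_cases h : i ∈ A <;> simp [h]
    simp only [hi, ← Finset.mul_sum]
    rw [Finset.sum_ite, Finset.sum_const, Finset.sum_const]
    have h1 : (Finset.univ.filter fun i => i ∈ A) = A := by ext; simp
    have h2 : (Finset.univ.filter fun i => i ∉ A) = Aᶜ := by ext; simp
    have h3 : A.card ≤ n := by simpa using A.card_le_univ
    rw [h1, h2, Finset.card_compl, Fintype.card_fin, nsmul_eq_mul, nsmul_eq_mul,
      Nat.cast_sub h3]
    ring
  · intro i _ i' _ hne
    refine Set.disjoint_left.2 fun x h1 h2 => hne ?_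
    exact h1.1.symm.trans h2.1
  · intro D _
    exact (Set.toFinite _).measurableSet

/-- The number of held types as an element of `{0, …, n}`. -/
def count (A : Finset (Fin n)) : Fin (n + 1) :=
  ⟨A.card, Nat.lt_succ_of_le (by simpa using A.card_le_univ)⟩

theorem roundLaw_real_count_step (p : unitInterval) [NeZero n] (A : Finset (Fin n))
    (j : Fin (n + 1)) :
    (roundLaw p n).real {x | count (step A x) = j}
      = countTransition (1 - (p : ℝ)) n (count A) j := by
  simp only [count, Fin.ext_iff]
  rw [roundLaw_real_card_step]
  rfl

theorem count_eq_last {A : Finset (Fin n)} : count A = Fin.last n ↔ A = Finset.univ := by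
  rw [count, Fin.ext_iff, Fin.val_last, ← Finset.card_eq_iff_eq_univ, Fintype.card_fin]

/-! ### The Markov property -/

/-- The σ-algebra generated by the rounds before round `t`. -/
abbrev past (n t : ℕ) : MeasurableSpace (Drive n) :=
  ⨆ s ∈ Set.Iio t, MeasurableSpace.comap (fun ω : Drive n => ω s) inferInstance

theorem past_mono {s t : ℕ} (h : s ≤ t) : past n s ≤ past n t :=
  biSup_mono fun _ hr => lt_of_lt_of_le hr h

theorem past_le (t : ℕ) : past n t ≤ MeasurableSpace.pi :=
  iSup₂_le fun s _ => (measurable_pi_apply s).comap_le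

theorem measurableSet_heldFrom_past (A : Finset (Fin n)) (t : ℕ) (S : Set (Finset (Fin n))) :
    MeasurableSet[past n t] {ω | heldFrom A t ω ∈ S} := by
  let _ : MeasurableSpace (Finset (Fin n)) := ⊤
  have : DiscreteMeasurableSpace (Finset (Fin n)) := ⟨fun _ => trivial⟩
  suffices h : Measurable[past n t] (heldFrom A t) from h trivial
  induction t with
  | zero => exact @measurable_const _ _ _ (past n 0) A
  | succ t ih =>
    have h1 : Measurable[past n (t + 1)] (heldFrom A t) := ih.mono (past_mono t.le_succ) le_rfl
    have h2 : Measurable[past n (t + 1)] (fun ω : Drive n => ω t) := by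
      refine Measurable.of_comap_le ?_
      exact le_biSup (fun s => MeasurableSpace.comap (fun ω : Drive n => ω s) inferInstance)
        (Set.mem_Iio.2 t.lt_succ_self)
    have h3 : Measurable[past n (t + 1)] (fun ω => (heldFrom A t ω, ω t)) :=
      Measurable.prodMk h1 h2
    exact (Measurable.of_discrete (f := fun y : Finset (Fin n) × (Fin n × (Fin n → Bool)) =>
      step y.1 y.2)).comp h3

theorem measurableSet_heldFrom (A : Finset (Fin n)) (t : ℕ) (S : Set (Finset (Fin n))) :
    MeasurableSet {ω | heldFrom A t ω ∈ S} :=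
  past_le t _ (measurableSet_heldFrom_past A t S)

theorem driveLaw_real_past_inter (p : unitInterval) [NeZero n] {t : ℕ} {E : Set (Drive n)}
    (hE : MeasurableSet[past n t] E) (D : Set (Fin n × (Fin n → Bool))) :
    (driveLaw p n).real (E ∩ {ω | ω t ∈ D}) = (driveLaw p n).real E * (roundLaw p n).real D := by
  have hD : MeasurableSet D := (Set.toFinite _).measurableSet
  have hind : iIndepFun (fun (s : ℕ) (ω : Drive n) => ω s) (driveLaw p n) :=
    iIndepFun_infinitePi (P := fun _ : ℕ => roundLaw p n) (X := fun _ x => x)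
      (fun _ => measurable_id)
  have h := indep_iSup_of_disjoint (fun s => (measurable_pi_apply s).comap_le)
    ((iIndepFun_iff_iIndep _ _ _).1 hind)
    (show Disjoint (Set.Iio t) {t} by simp)
  have hD' : MeasurableSet[⨆ s ∈ ({t} : Set ℕ),
      MeasurableSpace.comap (fun ω : Drive n => ω s) inferInstance] {ω | ω t ∈ D} := by
    exact le_biSup (fun s => MeasurableSpace.comap (fun ω : Drive n => ω s) inferInstance)
      (Set.mem_singleton t) _ ⟨D, hD, rfl⟩
  have h2 := (Indep_iff _ _ _).1 h E _ hE hD'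
  rw [measureReal_def, h2, ENNReal.toReal_mul, measureReal_def, measureReal_def]
  congr 2
  have h3 : (driveLaw p n).map (fun ω => ω t) = roundLaw p n :=
    Measure.infinitePi_map_eval (fun _ : ℕ => roundLaw p n) t
  rw [← h3, Measure.map_apply (measurable_pi_apply t) hD]
  rfl

/-- Refines a sum over counts to one over held sets, the level at which a fresh round acts. -/
theorem driveLaw_real_count_eq_sum (p : unitInterval) [NeZero n] {E : Set (Drive n)}
    (hE : MeasurableSet E) (A : Finset (Fin n)) (t : ℕ) (f : Fin (n + 1) → ℝ) :
    ∑ k, (driveLaw p n).real (E ∩ {ω | count (heldFrom A t ω) = k}) * f k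
      = ∑ B : Finset (Fin n), (driveLaw p n).real (E ∩ {ω | heldFrom A t ω = B}) * f (count B) := by
  have h : ∀ k, (driveLaw p n).real (E ∩ {ω | count (heldFrom A t ω) = k})
      = ∑ B with count B = k, (driveLaw p n).real (E ∩ {ω | heldFrom A t ω = B}) := by
    intro k
    rw [← measureReal_biUnion_finset]
    · congr 1
      ext ω
      simp
    · intro B _ B' _ hne
      exact Set.disjoint_left.2 fun ω h1 h2 => hne (h1.2.symm.trans h2.2)
    · exact fun B _ => hE.inter (measurableSet_heldFrom A t {B})
  rw [← Finset.sum_fiberwise (s := Finset.univ) (g := count)]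
  refine Finset.sum_congr rfl fun k _ => ?_
  rw [h, Finset.sum_mul]
  refine Finset.sum_congr rfl fun B hB => ?_
  rw [(Finset.mem_filter.1 hB).2]

/-- Round `t` is independent of the past, and its effect on the count depends on the held set only
through its size, so the set-valued chain lumps. The past event `E` is arbitrary so that the chain
can later be restarted on `{T = s}`. -/
theorem driveLaw_real_count_succ (p : unitInterval) [NeZero n] {t : ℕ} {E : Set (Drive n)}
    (hE : MeasurableSet[past n t] E) (A : Finset (Fin n)) (j : Fin (n + 1)) :
    (driveLaw p n).real (E ∩ {ω | count (heldFrom A (t + 1) ω) = j})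
      = ∑ k, (driveLaw p n).real (E ∩ {ω | count (heldFrom A t ω) = k})
          * countTransition (1 - (p : ℝ)) n k j := by
  rw [driveLaw_real_count_eq_sum p (past_le t _ hE)]
  have hset : E ∩ {ω | count (heldFrom A (t + 1) ω) = j}
      = ⋃ B ∈ (Finset.univ : Finset (Finset (Fin n))),
        (E ∩ {ω | heldFrom A t ω = B}) ∩ {ω | ω t ∈ {x | count (step B x) = j}} := by
    ext ω
    simp [heldFrom]
  have hm : ∀ B : Finset (Fin n), MeasurableSet[past n t] (E ∩ {ω | heldFrom A t ω = B}) :=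
    fun B => @MeasurableSet.inter _ (past n t) _ _ hE (measurableSet_heldFrom_past A t {B})
  rw [hset, measureReal_biUnion_finset]
  · refine Finset.sum_congr rfl fun B _ => ?_
    rw [driveLaw_real_past_inter p (hm B), roundLaw_real_count_step]
  · intro B _ B' _ hne
    exact Set.disjoint_left.2 fun ω h1 h2 => hne (h1.1.2.symm.trans h2.1.2)
  · exact fun B _ => (past_le t _ (hm B)).inter
      (measurable_pi_apply t (Set.toFinite _).measurableSet)

theorem driveLaw_real_count_add (p : unitInterval) [NeZero n] {s : ℕ} {E : Set (Drive n)}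
    (hE : MeasurableSet[past n s] E) (A : Finset (Fin n)) (m : ℕ) :
    (fun j => (driveLaw p n).real (E ∩ {ω | count (heldFrom A (s + m) ω) = j}))
      = Matrix.vecMul (fun j => (driveLaw p n).real (E ∩ {ω | count (heldFrom A s ω) = j}))
          (countTransition (1 - (p : ℝ)) n ^ m) := by
  induction m with
  | zero => simp
  | succ m ih =>
    rw [pow_succ, ← Matrix.vecMul_vecMul, ← ih]
    funext j
    exact driveLaw_real_count_succ p (past_mono (Nat.le_add_right s m) _ hE) A j

theorem driveLaw_real_count (p : unitInterval) [NeZero n] (A : Finset (Fin n)) (t : ℕ)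
    (j : Fin (n + 1)) :
    (driveLaw p n).real {ω | count (heldFrom A t ω) = j}
      = (countTransition (1 - (p : ℝ)) n ^ t) (count A) j := by
  have h := congrFun (driveLaw_real_count_add p (s := 0)
    (@MeasurableSet.univ _ (past n 0)) A t) j
  have h0 : (fun k => (driveLaw p n).real
      (Set.univ ∩ {ω : Drive n | count (heldFrom A 0 ω) = k})) = Pi.single (count A) 1 := by
    funext k
    by_cases hk : count A = k
    · subst hk; simp [heldFrom]
    · rw [Pi.single_eq_of_ne (Ne.symm hk)]; simp [heldFrom, hk]
  rw [h0, Matrix.single_one_vecMul] at h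
  simpa using h

/-! ### First completion and the renewal equation -/

/-- The probability that the collection is completed for the first time after round `t`. -/
def firstHit (p : unitInterval) (n t : ℕ) : ℝ :=
  (driveLaw p n).real {ω | completionTime n ω = t}

theorem completionTime_eq_iff {t : ℕ} {ω : Drive n} :
    completionTime n ω = t ↔
      heldFrom ∅ t ω = Finset.univ ∧ ∀ s < t, heldFrom ∅ s ω ≠ Finset.univ := by
  simp only [← held_eq_heldFrom]
  constructor
  · intro h
    have h' : hittingAfter (held (n := n)) {Finset.univ} 0 ω = WithTop.some t := h
    refine ⟨?_, fun s hs hu => ?_⟩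
    · have h1 := hittingAfter_mem_set_of_ne_top (u := held (n := n)) (s := {Finset.univ})
        (n := 0) (ω := ω) (by rw [h']; exact WithTop.coe_ne_top)
      rw [h'] at h1
      exact h1
    · have h1 : hittingAfter (held (n := n)) {Finset.univ} 0 ω ≤ WithTop.some s :=
        hittingAfter_le_of_mem s.zero_le hu
      rw [h'] at h1
      exact absurd (WithTop.coe_le_coe.1 h1) (by simpa using hs)
  · rintro ⟨h1, h2⟩
    change hittingAfter (held (n := n)) {Finset.univ} 0 ω = WithTop.some t
    refine le_antisymm (hittingAfter_le_of_mem t.zero_le h1) ?_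
    by_contra! hlt
    obtain ⟨s, hs⟩ := WithTop.ne_top_iff_exists.1 hlt.ne_top
    have h3 := hittingAfter_mem_set_of_ne_top (u := held (n := n)) (s := {Finset.univ})
        (n := 0) (ω := ω) hlt.ne_top
    rw [← hs] at hlt h3
    exact h2 s (WithTop.coe_lt_coe.1 hlt) h3

theorem measurableSet_completionTime_past (t : ℕ) :
    MeasurableSet[past n t] {ω : Drive n | completionTime n ω = t} := by
  have : {ω : Drive n | completionTime n ω = t} = {ω | heldFrom ∅ t ω ∈ ({Finset.univ} : Set _)} ∩
      ⋂ s ∈ Set.Iio t, {ω | heldFrom ∅ s ω ∈ ({Finset.univ}ᶜ : Set _)} := by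
    ext ω
    simp [completionTime_eq_iff]
  rw [this]
  refine @MeasurableSet.inter _ (past n t) _ _ (measurableSet_heldFrom_past _ _ _) ?_
  refine @MeasurableSet.biInter _ _ (past n t) _ _ (Set.to_countable _) fun s hs => ?_
  exact past_mono (le_of_lt hs) _ (measurableSet_heldFrom_past _ _ _)

theorem measurableSet_completionTime (t : ℕ) :
    MeasurableSet {ω : Drive n | completionTime n ω = t} :=
  past_le t _ (measurableSet_completionTime_past t)

/-- Restart at the first completion: `T = s` is decided before round `s`, and on it the chain sits
at the full state. -/
theorem driveLaw_real_hit_and_full (p : unitInterval) [NeZero n] (s m : ℕ) :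
    (driveLaw p n).real ({ω | completionTime n ω = s} ∩
        {ω | count (heldFrom ∅ (s + m) ω) = Fin.last n})
      = firstHit p n s * (countTransition (1 - (p : ℝ)) n ^ m) (Fin.last n) (Fin.last n) := by
  have h := congrFun (driveLaw_real_count_add p (measurableSet_completionTime_past s) ∅ m)
    (Fin.last n)
  have h0 : (fun k => (driveLaw p n).real
      ({ω : Drive n | completionTime n ω = s} ∩ {ω : Drive n | count (heldFrom ∅ s ω) = k}))
      = firstHit p n s • Pi.single (Fin.last n) 1 := by
    funext k
    by_cases hk : k = Fin.last n
    · subst hk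
      rw [Set.inter_eq_left.2]
      · simp [firstHit]
      · intro ω hω
        exact count_eq_last.2 (completionTime_eq_iff.1 hω).1
    · have : {ω : Drive n | completionTime n ω = s} ∩ {ω : Drive n | count (heldFrom ∅ s ω) = k}
          = ∅ := by
        refine Set.eq_empty_of_forall_notMem fun ω hω => hk ?_
        rw [← hω.2]
        exact count_eq_last.2 (completionTime_eq_iff.1 hω.1).1
      rw [this]
      simp [hk]
  rw [h0, Matrix.smul_vecMul, Matrix.single_one_vecMul] at h
  simpa using h

/-- The renewal equation for the visits to the complete collection. -/
theorem renewal_equation (p : unitInterval) [NeZero n] (t : ℕ) :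
    (countTransition (1 - (p : ℝ)) n ^ t) 0 (Fin.last n)
      = ∑ s ∈ Finset.range (t + 1), firstHit p n s *
          (countTransition (1 - (p : ℝ)) n ^ (t - s)) (Fin.last n) (Fin.last n) := by
  have h0 : count (∅ : Finset (Fin n)) = 0 := rfl
  rw [← h0, ← driveLaw_real_count]
  -- Being full at time `t` forces first completion at exactly one `s ≤ t`.
  have hset : {ω | count (heldFrom (∅ : Finset (Fin n)) t ω) = Fin.last n}
      = ⋃ s ∈ Finset.range (t + 1), {ω | completionTime n ω = s} ∩
        {ω | count (heldFrom ∅ t ω) = Fin.last n} := by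
    ext ω
    simp only [Set.mem_ofPred_eq, Set.mem_iUnion, Set.mem_inter_iff, exists_prop]
    refine ⟨fun h => ?_, fun ⟨_, _, _, h⟩ => h⟩
    classical
    have hex : ∃ s, heldFrom ∅ s ω = Finset.univ := ⟨t, count_eq_last.1 h⟩
    refine ⟨Nat.find hex, ?_, ?_, h⟩
    · exact Finset.mem_range.2 (Nat.lt_succ_of_le (Nat.find_min' hex (count_eq_last.1 h)))
    · exact completionTime_eq_iff.2 ⟨Nat.find_spec hex, fun s hs => Nat.find_min hex hs⟩
  rw [hset, measureReal_biUnion_finset]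
  · refine Finset.sum_congr rfl fun s hs => ?_
    rw [← driveLaw_real_hit_and_full, Nat.add_sub_cancel' (Nat.le_of_lt_succ (Finset.mem_range.1 hs))]
  · intro s _ s' _ hne
    refine Set.disjoint_left.2 fun ω h1 h2 => hne ?_
    exact_mod_cast h1.1.symm.trans h2.1
  · intro s _
    refine (measurableSet_completionTime s).inter ?_
    exact measurableSet_heldFrom ∅ t {B | count B = Fin.last n}

/-! ### Monotone coupling and coalescence -/

theorem step_mono {A B : Finset (Fin n)} (h : A ⊆ B) (x : Fin n × (Fin n → Bool)) :
    step A x ⊆ step B x :=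
  Finset.filter_subset_filter _ (Finset.insert_subset_insert _ h)

theorem heldFrom_mono {A B : Finset (Fin n)} (h : A ⊆ B) (t : ℕ) (ω : Drive n) :
    heldFrom A t ω ⊆ heldFrom B t ω := by
  induction t with
  | zero => exact h
  | succ t ih => exact step_mono ih _

/-- A loss of `i` removes it from both copies, and from then on the common draws and losses keep
them in agreement at `i`. -/
theorem never_lost_of_mem_of_notMem {A B : Finset (Fin n)} {t : ℕ} {ω : Drive n} {i : Fin n}
    (hA : i ∈ heldFrom A t ω) (hB : i ∉ heldFrom B t ω) : ∀ s < t, (ω s).2 i = false := by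
  induction t with
  | zero => simp
  | succ t ih =>
    simp only [heldFrom, step, Finset.mem_filter, Finset.mem_insert, not_and] at hA hB
    have h1 : ¬(i = (ω t).1 ∨ i ∈ heldFrom B t ω) := fun h => hB h hA.2
    push Not at h1
    intro s hs
    rcases Nat.lt_succ_iff_lt_or_eq.1 hs with h | rfl
    · exact ih (hA.1.resolve_left h1.1) h1.2 s h
    · exact hA.2

theorem roundLaw_real_not_lost (p : unitInterval) [NeZero n] (i : Fin n) :
    (roundLaw p n).real {x | x.2 i = false} = 1 - (p : ℝ) := by
  have hset : {x : Fin n × (Fin n → Bool) | x.2 i = false}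
      = Set.univ ×ˢ {L | ({i} : Finset (Fin n)).filter (fun k => L k = false) = {i}} := by
    ext x
    simp [Finset.filter_eq_self]
  rw [hset, measureReal_prod_prod, lossLaw_real_filter_eq p (Finset.Subset.refl _)]
  simp

theorem driveLaw_real_never_lost (p : unitInterval) [NeZero n] (i : Fin n) (t : ℕ) :
    (driveLaw p n).real {ω | ∀ s < t, (ω s).2 i = false} = (1 - (p : ℝ)) ^ t := by
  have hset : {ω : Drive n | ∀ s < t, (ω s).2 i = false}
      = Set.pi (Finset.range t) fun _ => {x | x.2 i = false} := by
    ext ω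
    simp [Set.mem_pi]
  rw [hset, measureReal_def, driveLaw, Measure.infinitePi_pi _
    (fun _ _ => (Set.toFinite _).measurableSet), Finset.prod_const, ENNReal.toReal_pow,
    Finset.card_range, ← measureReal_def]
  congr 1
  exact roundLaw_real_not_lost p i

/-- Union bound over the types that could still distinguish the two copies. -/
theorem driveLaw_real_heldFrom_ne (p : unitInterval) [NeZero n] (A : Finset (Fin n)) (t : ℕ) :
    (driveLaw p n).real {ω | heldFrom A t ω ≠ heldFrom ∅ t ω} ≤ n * (1 - (p : ℝ)) ^ t := by
  calc (driveLaw p n).real {ω | heldFrom A t ω ≠ heldFrom ∅ t ω}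
      ≤ (driveLaw p n).real (⋃ i ∈ (Finset.univ : Finset (Fin n)),
          {ω | ∀ s < t, (ω s).2 i = false}) := by
        refine measureReal_mono (fun ω hω => ?_) (measure_ne_top _ _)
        have hss := heldFrom_mono (Finset.empty_subset A) t ω
        have : ¬ heldFrom A t ω ⊆ heldFrom ∅ t ω := fun h => hω (h.antisymm hss)
        obtain ⟨i, hi, hi'⟩ := Finset.not_subset.1 this
        exact Set.mem_biUnion (Finset.mem_coe.2 (Finset.mem_univ i))
          (never_lost_of_mem_of_notMem hi hi')
    _ ≤ ∑ i : Fin n, (driveLaw p n).real {ω | ∀ s < t, (ω s).2 i = false} :=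
        measureReal_biUnion_finset_le _ _
    _ = n * (1 - (p : ℝ)) ^ t := by simp [driveLaw_real_never_lost]

theorem exists_count_eq (k : Fin (n + 1)) : ∃ A : Finset (Fin n), count A = k := by
  obtain ⟨A, -, hA⟩ := Finset.exists_subset_card_eq (s := (Finset.univ : Finset (Fin n)))
    (n := k) (by simpa using Nat.lt_succ_iff.1 k.2)
  exact ⟨A, Fin.ext hA⟩

theorem abs_countTransition_pow_sub_le (p : unitInterval) [NeZero n] (t : ℕ)
    (k j : Fin (n + 1)) :
    |(countTransition (1 - (p : ℝ)) n ^ t) k j - (countTransition (1 - (p : ℝ)) n ^ t) 0 j|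
      ≤ n * (1 - (p : ℝ)) ^ t := by
  obtain ⟨A, rfl⟩ := exists_count_eq k
  have h0 : (0 : Fin (n + 1)) = count (∅ : Finset (Fin n)) := rfl
  have hm : ∀ B : Finset (Fin n), MeasurableSet {ω | count (heldFrom B t ω) = j} :=
    fun B => measurableSet_heldFrom B t {C | count C = j}
  rw [h0, ← driveLaw_real_count, ← driveLaw_real_count]
  refine (abs_measureReal_sub_le_measureReal_symmDiff (hm _).nullMeasurableSet
    (hm _).nullMeasurableSet).trans (le_trans (measureReal_mono ?_) (driveLaw_real_heldFrom_ne p A t))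
  rintro ω (⟨h1, h2⟩ | ⟨h1, h2⟩) h
  · exact h2 (by simpa [h] using h1)
  · exact h2 (by simpa [h] using h1)

theorem countTransition_pow_mono (p : unitInterval) [NeZero n] (t : ℕ)
    {A B : Finset (Fin n)} (h : A ⊆ B) :
    (countTransition (1 - (p : ℝ)) n ^ t) (count A) (Fin.last n)
      ≤ (countTransition (1 - (p : ℝ)) n ^ t) (count B) (Fin.last n) := by
  rw [← driveLaw_real_count, ← driveLaw_real_count]
  refine measureReal_mono fun ω hω => ?_
  have h1 := heldFrom_mono h t ω
  have h2 : heldFrom A t ω = Finset.univ := count_eq_last.1 hω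
  rw [h2] at h1
  exact count_eq_last.2 (Finset.univ_subset_iff.1 h1)

theorem countTransition_pow_zero_le (p : unitInterval) [NeZero n] (t : ℕ) (k : Fin (n + 1)) :
    (countTransition (1 - (p : ℝ)) n ^ t) 0 (Fin.last n)
      ≤ (countTransition (1 - (p : ℝ)) n ^ t) k (Fin.last n) := by
  obtain ⟨A, rfl⟩ := exists_count_eq k
  exact countTransition_pow_mono p t (Finset.empty_subset A)

theorem countTransition_pow_le_last (p : unitInterval) [NeZero n] (t : ℕ) (k : Fin (n + 1)) :
    (countTransition (1 - (p : ℝ)) n ^ t) k (Fin.last n)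
      ≤ (countTransition (1 - (p : ℝ)) n ^ t) (Fin.last n) (Fin.last n) := by
  obtain ⟨A, rfl⟩ := exists_count_eq k
  have h := countTransition_pow_mono p t (Finset.subset_univ A)
  rwa [count_eq_last.2 (rfl : (Finset.univ : Finset (Fin n)) = _)] at h

theorem countTransition_pow_nonneg (p : unitInterval) [NeZero n] (t : ℕ) (k j : Fin (n + 1)) :
    0 ≤ (countTransition (1 - (p : ℝ)) n ^ t) k j := by
  obtain ⟨A, rfl⟩ := exists_count_eq k
  rw [← driveLaw_real_count]
  exact measureReal_nonneg

theorem sum_countTransition_pow (p : unitInterval) [NeZero n] (t : ℕ) (k : Fin (n + 1)) :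
    ∑ j, (countTransition (1 - (p : ℝ)) n ^ t) k j = 1 := by
  obtain ⟨A, rfl⟩ := exists_count_eq k
  simp only [← driveLaw_real_count]
  rw [← measureReal_biUnion_finset]
  · convert! probReal_univ (μ := driveLaw p n)
    ext ω
    simp
  · exact fun j _ j' _ hne => Set.disjoint_left.2 fun ω h1 h2 => hne (h1.symm.trans h2)
  · exact fun j _ => measurableSet_heldFrom A t {C | count C = j}

/-! ### Bounds on reaching the full state in one round -/

theorem binomialProb_le_pow {q : ℝ} (hq : 0 ≤ q) {k : ℕ} (hk : k ≤ n) :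
    binomialProb q k n ≤ q ^ n := by
  rcases hk.lt_or_eq with h | rfl
  · simp [binomialProb, Nat.choose_eq_zero_of_lt h, pow_nonneg hq]
  · simp [binomialProb]

theorem countTransition_last_le {q : ℝ} [NeZero n] (hq : 0 ≤ q) (k : Fin (n + 1)) :
    countTransition q n k (Fin.last n) ≤ q ^ n := by
  have hn : (0 : ℝ) < n := by exact_mod_cast NeZero.pos n
  simp only [countTransition, Matrix.of_apply, Fin.val_last]
  have hk : (k : ℕ) ≤ n := Nat.lt_succ_iff.1 k.2
  have hk' : ((k : ℕ) : ℝ) ≤ n := by exact_mod_cast hk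
  have h1 : ((k : ℕ) : ℝ) / n * binomialProb q k n ≤ (k : ℕ) / n * q ^ n :=
    mul_le_mul_of_nonneg_left (binomialProb_le_pow hq hk) (by positivity)
  have h2 : ((n : ℝ) - (k : ℕ)) / n * binomialProb q ((k : ℕ) + 1) n
      ≤ ((n : ℝ) - (k : ℕ)) / n * q ^ n := by
    -- The bound on the binomial probability needs `k + 1 ≤ n`; at `k = n` its coefficient vanishes.
    rcases hk.lt_or_eq with h | h
    · exact mul_le_mul_of_nonneg_left (binomialProb_le_pow hq h)
        (div_nonneg (sub_nonneg.2 hk') hn.le)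
    · simp [h]
  calc _ ≤ ((k : ℕ) : ℝ) / n * q ^ n + ((n : ℝ) - (k : ℕ)) / n * q ^ n := add_le_add h1 h2
    _ = q ^ n := by field_simp; ring

theorem countTransition_last_last {q : ℝ} [NeZero n] :
    countTransition q n (Fin.last n) (Fin.last n) = q ^ n := by
  have hn : (n : ℝ) ≠ 0 := by exact_mod_cast NeZero.ne n
  simp [countTransition, binomialProb, hn]

theorem countTransition_pow_last_le (p : unitInterval) [NeZero n] {t : ℕ} (ht : t ≠ 0)
    (k : Fin (n + 1)) :
    (countTransition (1 - (p : ℝ)) n ^ t) k (Fin.last n) ≤ (1 - (p : ℝ)) ^ n := by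
  obtain ⟨t, rfl⟩ := Nat.exists_eq_succ_of_ne_zero ht
  rw [Nat.succ_eq_add_one, pow_succ, Matrix.mul_apply]
  calc _ ≤ ∑ j, (countTransition (1 - (p : ℝ)) n ^ t) k j * (1 - (p : ℝ)) ^ n :=
        Finset.sum_le_sum fun j _ => mul_le_mul_of_nonneg_left
          (countTransition_last_le (sub_nonneg.2 p.2.2) j) (countTransition_pow_nonneg p t k j)
    _ = _ := by rw [← Finset.sum_mul, sum_countTransition_pow, one_mul]

/-! ### The stationary law: existence, uniqueness, comparison, flux -/

theorem IsStationaryLaw.vecMul_pow {q : ℝ} {ν : Fin (n + 1) → ℝ} (h : IsStationaryLaw q n ν)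
    (t : ℕ) : Matrix.vecMul ν (countTransition q n ^ t) = ν := by
  induction t with
  | zero => simp
  | succ t ih => rw [pow_succ, ← Matrix.vecMul_vecMul, ih, h.2]

theorem IsStationaryLaw.sum_mul_pow {q : ℝ} {ν : Fin (n + 1) → ℝ} (h : IsStationaryLaw q n ν)
    (t : ℕ) (j : Fin (n + 1)) : ∑ k, ν k * (countTransition q n ^ t) k j = ν j := by
  conv_rhs => rw [← h.vecMul_pow t]
  rfl

theorem abs_sum_mul_sub_le {ι : Type*} [Fintype ι] {ν f : ι → ℝ} (hν : ν ∈ stdSimplex ℝ ι)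
    {a b : ℝ} (h : ∀ k, |f k - a| ≤ b) : |∑ k, ν k * f k - a| ≤ b := by
  have h1 : ∑ k, ν k * f k - a = ∑ k, ν k * (f k - a) := by
    simp only [mul_sub, Finset.sum_sub_distrib, ← Finset.sum_mul, hν.2, one_mul]
  rw [h1]
  calc _ ≤ ∑ k, |ν k * (f k - a)| := Finset.abs_sum_le_sum_abs _ _
    _ ≤ ∑ k, ν k * b := Finset.sum_le_sum fun k _ => by
        rw [abs_mul, abs_of_nonneg (hν.1 k)]
        exact mul_le_mul_of_nonneg_left (h k) (hν.1 k)
    _ = b := by rw [← Finset.sum_mul, hν.2, one_mul]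

/-- `ν j` is the `ν`-average of the `t`-step probabilities from all starts `k`, each within `n q^t`
of the one from `0`. Uniqueness follows at once. -/
theorem IsStationaryLaw.tendsto_pow {p : unitInterval} (hp : 0 < p) [NeZero n]
    {ν : Fin (n + 1) → ℝ} (h : IsStationaryLaw (1 - (p : ℝ)) n ν) (j : Fin (n + 1)) :
    Tendsto (fun t : ℕ => (countTransition (1 - (p : ℝ)) n ^ t) 0 j) atTop (𝓝 (ν j)) := by
  have hp' : (0 : ℝ) < p := hp
  have h0 : Tendsto (fun t : ℕ => (n : ℝ) * (1 - (p : ℝ)) ^ t) atTop (𝓝 0) := by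
    simpa using (tendsto_pow_atTop_nhds_zero_of_lt_one (sub_nonneg.2 p.2.2)
      (by linarith : 1 - (p : ℝ) < 1)).const_mul (n : ℝ)
  refine tendsto_iff_dist_tendsto_zero.2 (squeeze_zero (fun _ => dist_nonneg) (fun t => ?_) h0)
  rw [dist_comm, Real.dist_eq, ← h.sum_mul_pow t j]
  exact abs_sum_mul_sub_le h.1 fun k => abs_countTransition_pow_sub_le p t k j

theorem IsStationaryLaw.unique {p : unitInterval} (hp : 0 < p) [NeZero n]
    {ν ν' : Fin (n + 1) → ℝ} (h : IsStationaryLaw (1 - (p : ℝ)) n ν)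
    (h' : IsStationaryLaw (1 - (p : ℝ)) n ν') : ν' = ν :=
  funext fun j => tendsto_nhds_unique (h'.tendsto_pow hp j) (h.tendsto_pow hp j)

/-- Conditioning on the first step writes the law at time `t + 1` as an average of laws at time `t`
from various starts. Coalescence then makes the sequence Cauchy at a geometric rate, and its limit
is stationary. -/
theorem exists_isStationaryLaw {p : unitInterval} (hp : 0 < p) [NeZero n] :
    ∃ ν, IsStationaryLaw (1 - (p : ℝ)) n ν := by
  have hp' : (0 : ℝ) < p := hp
  have hlim : ∀ j, ∃ a, Tendsto (fun t : ℕ => (countTransition (1 - (p : ℝ)) n ^ t) 0 j)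
      atTop (𝓝 a) := by
    intro j
    refine cauchySeq_tendsto_of_complete (cauchySeq_of_le_geometric (1 - (p : ℝ)) n
      (by linarith) fun t => ?_)
    rw [dist_comm, Real.dist_eq, pow_succ', Matrix.mul_apply]
    have hrow : countTransition (1 - (p : ℝ)) n 0 ∈ stdSimplex ℝ (Fin (n + 1)) := by
      have h1 := countTransition_pow_nonneg (n := n) p 1 0
      have h2 := sum_countTransition_pow (n := n) p 1 0
      rw [pow_one] at h1 h2
      exact ⟨h1, h2⟩
    exact abs_sum_mul_sub_le hrow fun k => abs_countTransition_pow_sub_le p t k j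
  choose ν hν using hlim
  refine ⟨ν, ⟨fun j => ge_of_tendsto' (hν j) fun t => countTransition_pow_nonneg p t 0 j, ?_⟩, ?_⟩
  · refine tendsto_nhds_unique (tendsto_finsetSum Finset.univ fun j _ => hν j) ?_
    simp only [sum_countTransition_pow]
    exact tendsto_const_nhds
  · funext j
    refine tendsto_nhds_unique ?_ ((hν j).comp (tendsto_add_atTop_nat 1))
    have : (fun t : ℕ => ∑ k, (countTransition (1 - (p : ℝ)) n ^ t) 0 k
        * countTransition (1 - (p : ℝ)) n k j)
        = (fun t : ℕ => (countTransition (1 - (p : ℝ)) n ^ t) 0 j) ∘ fun t => t + 1 := by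
      funext t
      simp only [Function.comp, pow_succ, Matrix.mul_apply]
    rw [← this]
    exact tendsto_finsetSum Finset.univ fun k _ => (hν k).mul_const _

/-- A stationary start is a mixture of starts, and by monotonicity the empty start is the least
favourable to being full; the full start in `last_le` is the most favourable. -/
theorem IsStationaryLaw.le_last {p : unitInterval} [NeZero n] {ν : Fin (n + 1) → ℝ}
    (h : IsStationaryLaw (1 - (p : ℝ)) n ν) (t : ℕ) :
    (countTransition (1 - (p : ℝ)) n ^ t) 0 (Fin.last n) ≤ ν (Fin.last n) := by
  rw [← h.sum_mul_pow t]
  calc _ = ∑ k, ν k * (countTransition (1 - (p : ℝ)) n ^ t) 0 (Fin.last n) := by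
        rw [← Finset.sum_mul, h.1.2, one_mul]
    _ ≤ _ := Finset.sum_le_sum fun k _ =>
        mul_le_mul_of_nonneg_left (countTransition_pow_zero_le p t k) (h.1.1 k)

theorem IsStationaryLaw.last_le {p : unitInterval} [NeZero n] {ν : Fin (n + 1) → ℝ}
    (h : IsStationaryLaw (1 - (p : ℝ)) n ν) (t : ℕ) :
    ν (Fin.last n) ≤ (countTransition (1 - (p : ℝ)) n ^ t) (Fin.last n) (Fin.last n) := by
  rw [← h.sum_mul_pow t]
  calc _ ≤ ∑ k, ν k * (countTransition (1 - (p : ℝ)) n ^ t) (Fin.last n) (Fin.last n) :=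
        Finset.sum_le_sum fun k _ =>
          mul_le_mul_of_nonneg_left (countTransition_pow_le_last p t k) (h.1.1 k)
    _ = _ := by rw [← Finset.sum_mul, h.1.2, one_mul]

theorem IsStationaryLaw.last_le_pow {p : unitInterval} [NeZero n] {ν : Fin (n + 1) → ℝ}
    (h : IsStationaryLaw (1 - (p : ℝ)) n ν) : ν (Fin.last n) ≤ (1 - (p : ℝ)) ^ n :=
  (h.last_le 1).trans (countTransition_pow_last_le p one_ne_zero _)

/-- Balance at the full state: its mass is the flux in plus the part `q ^ n` that stays because
nothing is lost. -/
theorem IsStationaryLaw.entryFlux_eq {q : ℝ} [NeZero n] {ν : Fin (n + 1) → ℝ}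
    (h : IsStationaryLaw q n ν) : entryFlux q n ν = ν (Fin.last n) * (1 - q ^ n) := by
  have h1 := h.sum_mul_pow 1 (Fin.last n)
  rw [pow_one, ← Finset.sum_erase_add _ _ (Finset.mem_univ (Fin.last n)),
    countTransition_last_last] at h1
  have h2 : (Finset.univ : Finset (Fin (n + 1))).erase (Fin.last n) = Finset.Iio (Fin.last n) := by
    ext k
    rw [Finset.mem_erase, Finset.mem_Iio, Fin.lt_last_iff_ne_last]
    simp
  rw [h2] at h1
  rw [entryFlux]
  linarith

/-! ### Binomial moments and the explicit stationary mass -/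

/-- An `m`-subset survives thinning with probability `q ^ m`. Algebraically, `C(k,j) C(j,m) = C(k,m)
C(k-m,j-m)` followed by the binomial theorem. -/
theorem sum_binomialProb_mul_choose (q : ℝ) {k N : ℕ} (h : k ≤ N) (m : ℕ) :
    ∑ j ∈ Finset.range (N + 1), binomialProb q k j * (j.choose m : ℝ)
      = q ^ m * (k.choose m : ℝ) := by
  rcases lt_or_ge k m with hkm | hkm
  · rw [Nat.choose_eq_zero_of_lt hkm, Nat.cast_zero, mul_zero]
    refine Finset.sum_eq_zero fun j _ => ?_
    rcases lt_or_ge k j with hj | hj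
    · simp [binomialProb, Nat.choose_eq_zero_of_lt hj]
    · simp [Nat.choose_eq_zero_of_lt (hj.trans_lt hkm)]
  · have hsub : Finset.Ico m (k + 1) ⊆ Finset.range (N + 1) := fun j hj => by
      simp only [Finset.mem_Ico, Finset.mem_range] at hj ⊢
      omega
    rw [← Finset.sum_subset hsub]
    · rw [Finset.sum_Ico_eq_sum_range, Nat.succ_sub hkm]
      have h1 := add_pow q (1 - q) (k - m)
      rw [add_sub_cancel, one_pow] at h1
      rw [← mul_one (q ^ m * (k.choose m : ℝ)), h1, Finset.mul_sum]
      refine Finset.sum_congr rfl fun i hi => ?_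
      have hi' : m + i ≤ k := by
        have := Finset.mem_range.1 hi
        omega
      have h2 : ((k.choose (m + i) : ℕ) : ℝ) * ((m + i).choose m : ℕ)
          = (k.choose m : ℕ) * ((k - m).choose i : ℕ) := by
        have := Nat.choose_mul (n := k) (Nat.le_add_right m i)
        rw [Nat.add_sub_cancel_left] at this
        exact_mod_cast this
      rw [binomialProb, Nat.sub_add_eq, pow_add]
      linear_combination (q ^ m * q ^ i * (1 - q) ^ (k - m - i)) * h2
    · intro j _ hj
      simp only [Finset.mem_Ico, not_and, not_lt] at hj
      rcases lt_or_ge j m with h3 | h3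
      · simp [Nat.choose_eq_zero_of_lt h3]
      · simp [binomialProb, Nat.choose_eq_zero_of_lt (Nat.lt_of_succ_le (hj h3))]

theorem cast_mul_choose (k m : ℕ) :
    (k : ℝ) * (k.choose m : ℝ) = (m + 1) * (k.choose (m + 1) : ℝ) + m * (k.choose m : ℝ) := by
  rcases lt_or_ge k m with h | h
  · simp [Nat.choose_eq_zero_of_lt h, Nat.choose_eq_zero_of_lt (h.trans m.lt_succ_self)]
  · have h1 : ((k.choose (m + 1) : ℕ) : ℝ) * (m + 1) = (k.choose m : ℕ) * ((k : ℝ) - m) := by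
      rw [← Nat.cast_sub h]
      exact_mod_cast Nat.choose_succ_right_eq k m
    linear_combination -h1

/-- Pascal's rule handles the added type, and `cast_mul_choose` absorbs the factor `k / n`. Only
orders `m + 1` and `m` appear, so the moments satisfy a closed recursion. -/
theorem sum_countTransition_mul_choose (q : ℝ) [NeZero n] (k : Fin (n + 1)) (m : ℕ) :
    ∑ j : Fin (n + 1), countTransition q n k j * ((j : ℕ).choose (m + 1) : ℝ)
      = q ^ (m + 1) * ((1 - (m + 1) / n) * ((k : ℕ).choose (m + 1) : ℝ)
          + (1 - m / n) * ((k : ℕ).choose m : ℝ)) := by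
  have hn : (n : ℝ) ≠ 0 := by exact_mod_cast NeZero.ne n
  have hk : (k : ℕ) ≤ n := Nat.lt_succ_iff.1 k.2
  have h1 : ∑ j : Fin (n + 1), countTransition q n k j * ((j : ℕ).choose (m + 1) : ℝ)
      = ((k : ℕ) : ℝ) / n * ∑ j ∈ Finset.range (n + 1), binomialProb q k j * (j.choose (m + 1) : ℝ)
        + ((n : ℝ) - (k : ℕ)) / n *
          ∑ j ∈ Finset.range (n + 1), binomialProb q (k + 1) j * (j.choose (m + 1) : ℝ) := by
    rw [Finset.mul_sum, Finset.mul_sum, ← Finset.sum_add_distrib, ← Fin.sum_univ_eq_sum_range]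
    refine Finset.sum_congr rfl fun j _ => ?_
    simp only [countTransition, Matrix.of_apply]
    ring
  have h2 : ((n : ℝ) - (k : ℕ)) / n *
      ∑ j ∈ Finset.range (n + 1), binomialProb q (k + 1) j * (j.choose (m + 1) : ℝ)
      = ((n : ℝ) - (k : ℕ)) / n * (q ^ (m + 1) * (((k : ℕ) + 1).choose (m + 1) : ℝ)) := by
    rcases hk.lt_or_eq with h | h
    · rw [sum_binomialProb_mul_choose q h]
    · simp [h]
  rw [h1, h2, sum_binomialProb_mul_choose q hk, Nat.choose_succ_succ, Nat.cast_add]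
  field_simp
  linear_combination (-q ^ (m + 1)) * cast_mul_choose k m

/-- The denominator of the stationary probability of the complete collection. -/
def stationaryDenom (q : ℝ) (n m : ℕ) : ℝ :=
  ∏ i ∈ Finset.range m, (1 - q ^ (i + 1) * (1 - (i + 1) / n))

theorem one_sub_pow_mul_pos {q : ℝ} (hq0 : 0 ≤ q) (hq1 : q < 1) (n i : ℕ) :
    0 < 1 - q ^ (i + 1) * (1 - ((i : ℝ) + 1) / n) := by
  have h1 : q ^ (i + 1) < 1 := pow_lt_one₀ hq0 hq1 i.succ_ne_zero
  have h2 : 0 ≤ q ^ (i + 1) := pow_nonneg hq0 _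
  have h3 : 0 ≤ ((i : ℝ) + 1) / n := by positivity
  nlinarith [mul_nonneg h2 h3]

theorem IsStationaryLaw.sum_mul_choose {q : ℝ} (hq0 : 0 ≤ q) (hq1 : q < 1) [NeZero n]
    {ν : Fin (n + 1) → ℝ} (h : IsStationaryLaw q n ν) (m : ℕ) :
    ∑ k : Fin (n + 1), ν k * ((k : ℕ).choose m : ℝ)
      = (∏ i ∈ Finset.range m, (q ^ (i + 1) * (1 - i / n))) / stationaryDenom q n m := by
  induction m with
  | zero => simp [stationaryDenom, h.1.2]
  | succ m ih =>
    have h1 : ∑ k : Fin (n + 1), ν k * ((k : ℕ).choose (m + 1) : ℝ)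
        = q ^ (m + 1) * ((1 - (m + 1) / n) * ∑ k : Fin (n + 1), ν k * ((k : ℕ).choose (m + 1) : ℝ)
          + (1 - m / n) * ∑ k : Fin (n + 1), ν k * ((k : ℕ).choose m : ℝ)) := by
      calc ∑ k : Fin (n + 1), ν k * ((k : ℕ).choose (m + 1) : ℝ)
          = ∑ j : Fin (n + 1), (∑ k, ν k * countTransition q n k j)
              * ((j : ℕ).choose (m + 1) : ℝ) := by
            refine Finset.sum_congr rfl fun j _ => ?_
            have := h.sum_mul_pow 1 j
            rw [pow_one] at this
            rw [this]
        _ = ∑ k, ν k * ∑ j : Fin (n + 1), countTransition q n k j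
              * ((j : ℕ).choose (m + 1) : ℝ) := by
            simp only [Finset.sum_mul, Finset.mul_sum]
            rw [Finset.sum_comm]
            simp only [mul_assoc]
        _ = _ := by
            simp only [sum_countTransition_mul_choose, Finset.mul_sum, ← Finset.sum_add_distrib]
            refine Finset.sum_congr rfl fun k _ => ?_
            ring
    rw [ih] at h1
    have hd : stationaryDenom q n (m + 1)
        = stationaryDenom q n m * (1 - q ^ (m + 1) * (1 - ((m : ℝ) + 1) / n)) :=
      Finset.prod_range_succ _ _
    have hpos := one_sub_pow_mul_pos hq0 hq1 n m
    have hpos' : stationaryDenom q n m ≠ 0 :=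
      Finset.prod_ne_zero_iff.2 fun i _ => (one_sub_pow_mul_pos hq0 hq1 n i).ne'
    rw [Finset.prod_range_succ, hd, ← div_mul_div_comm, mul_div_assoc', eq_div_iff hpos.ne']
    linear_combination h1

/-- On `{0, …, n}` the function `C(k, n)` is the indicator of `k = n`, so the top binomial moment is
the mass sought. -/
theorem IsStationaryLaw.last_eq {q : ℝ} (hq0 : 0 ≤ q) (hq1 : q < 1) [NeZero n]
    {ν : Fin (n + 1) → ℝ} (h : IsStationaryLaw q n ν) :
    ν (Fin.last n)
      = (n.factorial : ℝ) / (n : ℝ) ^ n * q ^ (n * (n + 1) / 2) / stationaryDenom q n n := by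
  have hn : (n : ℝ) ≠ 0 := by exact_mod_cast NeZero.ne n
  have h1 : ∑ k : Fin (n + 1), ν k * ((k : ℕ).choose n : ℝ) = ν (Fin.last n) := by
    rw [Finset.sum_eq_single (Fin.last n)]
    · simp
    · intro k _ hk
      have : (k : ℕ) < n := Fin.lt_last_iff_ne_last.2 hk
      simp [Nat.choose_eq_zero_of_lt this]
    · simp
  rw [← h1, h.sum_mul_choose hq0 hq1, Finset.prod_mul_distrib, Finset.prod_pow_eq_pow_sum]
  have h2 : ∑ i ∈ Finset.range n, (i + 1) = n * (n + 1) / 2 := by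
    have := Finset.sum_range_id (n + 1)
    rw [Finset.sum_range_succ'] at this
    simpa [mul_comm] using this
  have h3 : ∏ i ∈ Finset.range n, (1 - (i : ℝ) / n) = (n.factorial : ℝ) / (n : ℝ) ^ n := by
    rw [← Nat.descFactorial_self, Nat.descFactorial_eq_prod_range, Nat.cast_prod,
      eq_div_iff (pow_ne_zero n hn)]
    conv_lhs => rw [← Finset.card_range n, ← Finset.prod_const]
    rw [Finset.card_range, ← Finset.prod_mul_distrib]
    refine Finset.prod_congr rfl fun i hi => ?_
    rw [Nat.cast_sub (Finset.mem_range.1 hi).le]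
    field_simp
  rw [h2, h3, mul_comm (q ^ _)]

/-! ### Convergence of the denominator to `(q;q)_∞` -/

theorem summable_pow_succ {q : ℝ} (hq0 : 0 ≤ q) (hq1 : q < 1) :
    Summable fun r : ℕ => q ^ (r + 1) :=
  (summable_nat_add_iff 1).2 (summable_geometric_of_lt_one hq0 hq1)

theorem tendsto_prod_qPoch {q : ℝ} (hq0 : 0 ≤ q) (hq1 : q < 1) :
    Tendsto (fun n : ℕ => ∏ i ∈ Finset.range n, (1 - q ^ (i + 1))) atTop (𝓝 (qPoch q)) := by
  have h : Multipliable fun r : ℕ => 1 + -q ^ (r + 1) :=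
    Real.multipliable_one_add_of_summable (summable_pow_succ hq0 hq1).neg
  simp only [← sub_eq_add_neg] at h
  exact h.hasProd.tendsto_prod_nat

theorem qPoch_ne_zero {q : ℝ} (hq0 : 0 ≤ q) (hq1 : q < 1) : qPoch q ≠ 0 := by
  have h := tprod_one_add_ne_zero_of_summable (R := ℝ) (f := fun r : ℕ => -q ^ (r + 1))
    (fun r => by
      have := pow_lt_one₀ hq0 hq1 r.succ_ne_zero
      rw [← sub_eq_add_neg]
      exact (sub_pos.2 this).ne') (summable_pow_succ hq0 hq1).neg.norm
  simp only [← sub_eq_add_neg] at h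
  exact h

/-- Each factor exceeds `1 - q^(i+1)` by `y = (i+1) q^(i+1) / n`, hence by a ratio of at most `exp
(y / (1 - q))`. As `∑ (i+1) q^(i+1)` converges, all the ratios together contribute only `exp
(O(1/n))`. -/
theorem tendsto_stationaryDenom {q : ℝ} (hq0 : 0 ≤ q) (hq1 : q < 1) :
    Tendsto (fun n : ℕ => stationaryDenom q n n) atTop (𝓝 (qPoch q)) := by
  have hs : Summable fun i : ℕ => ((i : ℝ) + 1) * q ^ (i + 1) := by
    have h1 : Summable fun i : ℕ => (i : ℝ) ^ 1 * q ^ i :=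
      summable_pow_mul_geometric_of_norm_lt_one 1 (by rwa [Real.norm_of_nonneg hq0])
    simpa using (summable_nat_add_iff 1).2 h1
  set S := ∑' i : ℕ, ((i : ℝ) + 1) * q ^ (i + 1) with hS
  have hlow : ∀ n : ℕ, ∏ i ∈ Finset.range n, (1 - q ^ (i + 1)) ≤ stationaryDenom q n n := by
    intro n
    refine Finset.prod_le_prod (fun i _ => ?_) fun i _ => ?_
    · exact (sub_pos.2 (pow_lt_one₀ hq0 hq1 i.succ_ne_zero)).le
    · have h2 : 0 ≤ q ^ (i + 1) := pow_nonneg hq0 _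
      have h3 : 0 ≤ ((i : ℝ) + 1) / n := by positivity
      nlinarith [mul_nonneg h2 h3]
  have hup : ∀ n : ℕ, stationaryDenom q n n
      ≤ (∏ i ∈ Finset.range n, (1 - q ^ (i + 1))) * Real.exp (S / (1 - q) / n) := by
    intro n
    have hterm : ∀ i ∈ Finset.range n, 1 - q ^ (i + 1) * (1 - ((i : ℝ) + 1) / n)
        ≤ (1 - q ^ (i + 1)) * Real.exp (((i : ℝ) + 1) * q ^ (i + 1) / (1 - q) / n) := by
      intro i _
      have h1 : 1 - q ≤ 1 - q ^ (i + 1) := by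
        have : q ^ (i + 1) ≤ q := pow_le_of_le_one hq0 hq1.le i.succ_ne_zero
        linarith
      have hq : 0 < 1 - q := by linarith
      set y := ((i : ℝ) + 1) * q ^ (i + 1) / n with hy
      have hy0 : 0 ≤ y := by positivity
      have e1 : ((i : ℝ) + 1) * q ^ (i + 1) / (1 - q) / n = y / (1 - q) := by
        rw [hy, div_right_comm]
      have e2 : 1 - q ^ (i + 1) * (1 - ((i : ℝ) + 1) / n) = 1 - q ^ (i + 1) + y := by
        rw [hy]; ring
      rw [e1, e2]
      have h4 : 1 + y / (1 - q) ≤ Real.exp (y / (1 - q)) := by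
        rw [add_comm]; exact Real.add_one_le_exp _
      have h5 : y ≤ (1 - q ^ (i + 1)) * (y / (1 - q)) := by
        calc y = (1 - q) * (y / (1 - q)) := by field_simp
          _ ≤ _ := mul_le_mul_of_nonneg_right h1 (div_nonneg hy0 hq.le)
      nlinarith [mul_le_mul_of_nonneg_left h4 (hq.le.trans h1)]
    refine (Finset.prod_le_prod (fun i _ => (one_sub_pow_mul_pos hq0 hq1 n i).le) hterm).trans ?_
    rw [Finset.prod_mul_distrib, ← Real.exp_sum, ← Finset.sum_div, ← Finset.sum_div]
    refine mul_le_mul_of_nonneg_left (Real.exp_le_exp.2 ?_) (Finset.prod_nonneg fun i _ =>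
      (sub_pos.2 (pow_lt_one₀ hq0 hq1 i.succ_ne_zero)).le)
    have hq : 0 ≤ 1 - q := by linarith
    gcongr
    exact hs.sum_le_tsum _ fun i _ => by positivity
  refine tendsto_of_tendsto_of_tendsto_of_le_of_le (tendsto_prod_qPoch hq0 hq1) ?_ hlow hup
  have h0 : Tendsto (fun n : ℕ => Real.exp (S / (1 - q) / n)) atTop (𝓝 1) := by
    rw [← Real.exp_zero]
    exact (Real.continuous_exp.tendsto _).comp (tendsto_const_div_atTop_nhds_zero_nat _)
  simpa using (tendsto_prod_qPoch hq0 hq1).mul h0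

/-! ### Nearly geometric sequences and exponential tails -/

/-- The tail `1 - ∑_{s < t} h s` of a sub-probability sequence. -/
def tail (h : ℕ → ℝ) (t : ℕ) : ℝ := 1 - ∑ s ∈ Finset.range t, h s

theorem tail_succ (h : ℕ → ℝ) (t : ℕ) : tail h (t + 1) = tail h t - h t := by
  rw [tail, tail, Finset.sum_range_succ]; ring

/-- The sub-probability sequence `h` has hazard rate close to `a`, with an error which is
`b` times a convolution with a geometric sequence of ratio `ρ`. -/
structure NearGeometric (h : ℕ → ℝ) (a b ρ : ℝ) : Prop where
  nonneg : ∀ t, 0 ≤ h t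
  tail_nonneg : ∀ t, 0 ≤ tail h t
  rate_pos : 0 < a
  error_nonneg : 0 ≤ b
  ratio_nonneg : 0 ≤ ρ
  le_rate_mul_tail : ∀ t, h t ≤ a * tail h t
  rate_mul_tail_le : ∀ t,
    a * tail h t ≤ h t + b * ∑ s ∈ Finset.range t, h s * ρ ^ (t - s) + b * ρ ^ t

theorem nearGeometric_of_renewal {h u r : ℕ → ℝ} {a b ρ : ℝ} (hnonneg : ∀ t, 0 ≤ h t)
    (htail : ∀ t, 0 ≤ tail h t) (ha : 0 < a) (hb : 0 ≤ b) (hρ : 0 ≤ ρ) (hr0 : r 0 = 1)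
    (hren : ∀ t, u t = ∑ s ∈ Finset.range (t + 1), h s * r (t - s))
    (hu : ∀ t, u t ≤ a) (hu' : ∀ t, a ≤ u t + b * ρ ^ t)
    (hr : ∀ t, a ≤ r t) (hr' : ∀ t, t ≠ 0 → r t ≤ a + b * ρ ^ t) : NearGeometric h a b ρ := by
  -- The renewal equation with `a ∑_{s<t} h s` subtracted; the term `s = t` is `h t` because `r 0 =
  -- 1`.
  have key : ∀ t, a * tail h t
      = h t + ∑ s ∈ Finset.range t, h s * (r (t - s) - a) + (a - u t) := by
    intro t
    rw [hren t, Finset.sum_range_succ, Nat.sub_self, hr0, tail]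
    simp only [mul_sub, Finset.sum_sub_distrib, ← Finset.sum_mul]
    ring
  refine ⟨hnonneg, htail, ha, hb, hρ, fun t => ?_, fun t => ?_⟩
  · rw [key]
    have : 0 ≤ ∑ s ∈ Finset.range t, h s * (r (t - s) - a) :=
      Finset.sum_nonneg fun s _ => mul_nonneg (hnonneg s) (sub_nonneg.2 (hr _))
    linarith [hu t]
  · rw [key, Finset.mul_sum]
    have : ∑ s ∈ Finset.range t, h s * (r (t - s) - a)
        ≤ ∑ s ∈ Finset.range t, b * (h s * ρ ^ (t - s)) := by
      refine Finset.sum_le_sum fun s hs => ?_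
      have h1 := hr' (t - s) (Nat.sub_ne_zero_of_lt (Finset.mem_range.1 hs))
      nlinarith [mul_le_mul_of_nonneg_left (sub_le_iff_le_add'.2 h1) (hnonneg s)]
    linarith [hu' t]

/-- After exchanging the sums, submultiplicativity splits `w t` into `w s * w (t - s)`, and the
second factor is summed against `ρ ^ (t - s)`. -/
theorem sum_mul_convolution_le {h w : ℕ → ℝ} {ρ W : ℝ} (hh : ∀ t, 0 ≤ h t) (hw : ∀ t, 0 ≤ w t)
    (hρ : 0 ≤ ρ) (hsub : ∀ s j, w (s + j) ≤ w s * w j)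
    (hW : ∀ N, ∑ j ∈ Finset.range N, w j * ρ ^ j ≤ W) (N : ℕ) :
    ∑ t ∈ Finset.range N, w t * ∑ s ∈ Finset.range t, h s * ρ ^ (t - s)
      ≤ (∑ s ∈ Finset.range N, h s * w s) * W := by
  have hswap : ∑ t ∈ Finset.range N, w t * ∑ s ∈ Finset.range t, h s * ρ ^ (t - s)
      = ∑ s ∈ Finset.range N, ∑ t ∈ Finset.Ico (s + 1) N, w t * (h s * ρ ^ (t - s)) := by
    simp only [Finset.mul_sum]
    refine Finset.sum_comm' fun t s => ?_
    simp only [Finset.mem_range, Finset.mem_Ico]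
    omega
  rw [hswap, Finset.sum_mul]
  refine Finset.sum_le_sum fun s _ => ?_
  rw [Finset.sum_Ico_eq_sum_range]
  calc ∑ i ∈ Finset.range (N - (s + 1)), w (s + 1 + i) * (h s * ρ ^ (s + 1 + i - s))
      ≤ ∑ i ∈ Finset.range (N - (s + 1)), h s * w s * (w (i + 1) * ρ ^ (i + 1)) := by
        refine Finset.sum_le_sum fun i _ => ?_
        have e : s + 1 + i = s + (i + 1) := by ring
        rw [e, Nat.add_sub_cancel_left]
        have := mul_le_mul_of_nonneg_right (hsub s (i + 1))
          (mul_nonneg (hh s) (pow_nonneg hρ (i + 1)))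
        linarith
    _ = h s * w s * ∑ i ∈ Finset.range (N - (s + 1)), w (i + 1) * ρ ^ (i + 1) := by
        rw [Finset.mul_sum]
    _ ≤ h s * w s * W := by
        refine mul_le_mul_of_nonneg_left ?_ (mul_nonneg (hh s) (hw s))
        -- The lags start at `1`; the bound `W` includes lag `0`, whose term is nonnegative and is
        -- dropped.
        have h1 := hW (N - (s + 1) + 1)
        rw [Finset.sum_range_succ'] at h1
        have h2 : 0 ≤ w 0 * ρ ^ 0 := mul_nonneg (hw 0) (by simp)
        linarith

namespace NearGeometric

variable {h : ℕ → ℝ} {a b ρ : ℝ}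

theorem sum_weight_mul_tail_le (H : NearGeometric h a b ρ) {w : ℕ → ℝ} {W : ℝ}
    (hw : ∀ t, 0 ≤ w t) (hsub : ∀ s j, w (s + j) ≤ w s * w j)
    (hW : ∀ N, ∑ j ∈ Finset.range N, w j * ρ ^ j ≤ W) (N : ℕ) :
    a * ∑ t ∈ Finset.range N, w t * tail h t
      ≤ (∑ t ∈ Finset.range N, h t * w t) * (1 + b * W) + b * W := by
  have h1 : a * ∑ t ∈ Finset.range N, w t * tail h t
      ≤ ∑ t ∈ Finset.range N, (h t * w t
        + b * (w t * ∑ s ∈ Finset.range t, h s * ρ ^ (t - s)) + b * (w t * ρ ^ t)) := by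
    rw [Finset.mul_sum]
    refine Finset.sum_le_sum fun t _ => ?_
    have := mul_le_mul_of_nonneg_left (H.rate_mul_tail_le t) (hw t)
    linarith
  rw [Finset.sum_add_distrib, Finset.sum_add_distrib, ← Finset.mul_sum, ← Finset.mul_sum] at h1
  have h2 := mul_le_mul_of_nonneg_left
    (sum_mul_convolution_le H.nonneg hw H.ratio_nonneg hsub hW N) H.error_nonneg
  have h3 := mul_le_mul_of_nonneg_left (hW N) H.error_nonneg
  linarith

theorem tail_le_tail (H : NearGeometric h a b ρ) (t : ℕ) : tail h (t + 1) ≤ tail h t := by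
  rw [tail_succ]; linarith [H.nonneg t]

theorem le_tail (H : NearGeometric h a b ρ) (t : ℕ) : h t ≤ tail h t := by
  have := H.tail_nonneg (t + 1)
  rw [tail_succ] at this
  linarith

/-- With `A = ∑ h_t z^t` and `bW ≤ 1/4`, summation by parts and the hazard bound give `A + tail·z^N
≤ 1 + (A (1 + bW) + bW) / 2`. Choosing `z - 1 = a / 2`, half the rate, keeps the coefficient of `A`
on the right below `1`, so `A` can be absorbed. -/
theorem tail_mul_pow_le (H : NearGeometric h a b ρ) (hz : (1 + a / 2) * ρ < 1)
    (hb : b * (1 - (1 + a / 2) * ρ)⁻¹ ≤ 1 / 4) (N : ℕ) : tail h N * (1 + a / 2) ^ N ≤ 3 := by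
  have ha := H.rate_pos
  set z := 1 + a / 2 with hzdef
  have hz0 : 0 < z := by positivity
  -- Summation by parts, using `h t = tail h t - tail h (t + 1)` and `z - 1 = a / 2`.
  have hparts : ∀ M, ∑ t ∈ Finset.range M, h t * z ^ t + tail h M * z ^ M
      ≤ 1 + a / 2 * ∑ t ∈ Finset.range M, z ^ t * tail h t := by
    intro M
    induction M with
    | zero => simp [tail]
    | succ M ih =>
      rw [Finset.sum_range_succ, Finset.sum_range_succ]
      have h1 : h M = tail h M - tail h (M + 1) := by rw [tail_succ]; ring
      have h2 : tail h (M + 1) * z ^ (M + 1)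
          = tail h (M + 1) * z ^ M + a / 2 * (z ^ M * tail h (M + 1)) := by
        rw [pow_succ, hzdef]; ring
      have h3 : a / 2 * (z ^ M * tail h (M + 1)) ≤ a / 2 * (z ^ M * tail h M) := by
        have := H.tail_le_tail M
        gcongr
      have h4 : h M * z ^ M = tail h M * z ^ M - tail h (M + 1) * z ^ M := by rw [h1]; ring
      rw [h2, h4, mul_add]
      linarith
  have hgeom : ∀ M, ∑ j ∈ Finset.range M, z ^ j * ρ ^ j ≤ (1 - z * ρ)⁻¹ := by
    intro M
    have h0 : 0 ≤ z * ρ := mul_nonneg hz0.le H.ratio_nonneg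
    simp only [← mul_pow]
    rw [← tsum_geometric_of_lt_one h0 hz]
    exact (summable_geometric_of_lt_one h0 hz).sum_le_tsum _ fun i _ => pow_nonneg h0 i
  have h1 := H.sum_weight_mul_tail_le (w := fun t => z ^ t) (fun t => pow_nonneg hz0.le t)
    (fun s j => (pow_add z s j).le) hgeom N
  have h2 := hparts N
  have h3 : 0 ≤ ∑ t ∈ Finset.range N, h t * z ^ t :=
    Finset.sum_nonneg fun t _ => mul_nonneg (H.nonneg t) (pow_nonneg hz0.le t)
  have h4 : 0 ≤ tail h N * z ^ N := mul_nonneg (H.tail_nonneg N) (pow_nonneg hz0.le N)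
  have h5 := mul_le_mul_of_nonneg_left hb h3
  linarith

end NearGeometric

/-! ### Moments with binomial weights -/

/-- The weight `(t + k).choose k`, as a real number. -/
def chooseWeight (k t : ℕ) : ℝ := ((t + k).choose k : ℝ)

theorem chooseWeight_nonneg (k t : ℕ) : 0 ≤ chooseWeight k t := Nat.cast_nonneg _

theorem succ_mul_chooseWeight_succ (k t : ℕ) :
    ((k : ℝ) + 1) * chooseWeight (k + 1) t = ((t : ℝ) + k + 1) * chooseWeight k t := by
  have h := Nat.add_one_mul_choose_eq (t + k) k
  have h' : (((t + k + 1 : ℕ) : ℝ)) * ((t + k).choose k : ℝ)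
      = ((t + k + 1).choose (k + 1) : ℝ) * ((k + 1 : ℕ) : ℝ) := by exact_mod_cast h
  push_cast at h'
  rw [chooseWeight, chooseWeight, ← add_assoc]
  linarith

/-- Each increment of `k` multiplies the weight by `1 + t / (k + 1)`, and `1 + x + y ≤ (1 + x) (1 +
y)` for `x, y ≥ 0`. -/
theorem chooseWeight_add_le (k s j : ℕ) :
    chooseWeight k (s + j) ≤ chooseWeight k s * chooseWeight k j := by
  induction k with
  | zero => simp [chooseWeight]
  | succ k ih =>
    have hk : (0 : ℝ) < (k : ℝ) + 1 := by positivity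
    have e : ∀ t, chooseWeight (k + 1) t = ((t : ℝ) + k + 1) / (k + 1) * chooseWeight k t := by
      intro t
      rw [div_mul_eq_mul_div, eq_div_iff hk.ne', mul_comm, succ_mul_chooseWeight_succ]
    rw [e, e, e]
    have h1 : (((s + j : ℕ) : ℝ) + k + 1) / (k + 1)
        ≤ ((s : ℝ) + k + 1) / (k + 1) * (((j : ℝ) + k + 1) / (k + 1)) := by
      rw [div_mul_div_comm, div_le_div_iff₀ hk (by positivity)]
      push_cast
      have : (0 : ℝ) ≤ s * j * (k + 1) := by positivity
      linarith
    calc _ ≤ ((s : ℝ) + k + 1) / (k + 1) * (((j : ℝ) + k + 1) / (k + 1))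
          * (chooseWeight k s * chooseWeight k j) :=
          mul_le_mul h1 ih (chooseWeight_nonneg _ _) (by positivity)
      _ = _ := by ring

theorem sum_chooseWeight (k N : ℕ) :
    ∑ t ∈ Finset.range (N + 1), chooseWeight k t = chooseWeight (k + 1) N := by
  induction N with
  | zero => simp [chooseWeight]
  | succ N ih =>
    rw [Finset.sum_range_succ, ih, chooseWeight, chooseWeight, chooseWeight,
      show N + 1 + (k + 1) = N + 1 + k + 1 by ring, Nat.choose_succ_succ,
      show N + (k + 1) = N + 1 + k by ring]
    push_cast
    ring

theorem summable_chooseWeight_mul_pow (k : ℕ) {ρ : ℝ} (h0 : 0 ≤ ρ) (h1 : ρ < 1) :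
    Summable fun t => chooseWeight k t * ρ ^ t :=
  summable_choose_mul_geometric_of_norm_lt_one k (by rwa [Real.norm_of_nonneg h0])

/-- Summation by parts with the hockey-stick identity: summing the tail against order `k` produces
the moment of order `k + 1`. This turns the hazard bounds into a recursion on moments. -/
theorem sum_chooseWeight_mul_tail (h : ℕ → ℝ) (k N : ℕ) :
    ∑ t ∈ Finset.range N, chooseWeight k t * tail h t
      = ∑ t ∈ Finset.range N, h t * chooseWeight (k + 1) t
        + tail h N * ∑ t ∈ Finset.range N, chooseWeight k t := by
  induction N with
  | zero => simp
  | succ N ih =>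
    have h1 := sum_chooseWeight k N
    have h2 : ∑ t ∈ Finset.range N, chooseWeight k t
        = chooseWeight (k + 1) N - chooseWeight k N := by
      rw [← h1, Finset.sum_range_succ]; ring
    rw [Finset.sum_range_succ, ih, Finset.sum_range_succ _ N, h1, h2, tail_succ]
    ring

/-- The moments of a sub-probability sequence with respect to the weights `chooseWeight k`. -/
def chooseMoment (h : ℕ → ℝ) (k : ℕ) : ℝ := ∑' t, h t * chooseWeight k t

namespace NearGeometric

variable {h : ℕ → ℝ} {a b ρ z : ℝ}

theorem tail_le_inv_pow {C : ℝ} (hz : 1 < z) (ht : ∀ N, tail h N * z ^ N ≤ C) (N : ℕ) :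
    tail h N ≤ C * z⁻¹ ^ N := by
  have hz0 : 0 < z ^ N := pow_pos (by linarith) N
  rw [inv_pow, ← div_eq_mul_inv, le_div_iff₀ hz0]
  exact ht N

theorem summable_mul_chooseWeight (H : NearGeometric h a b ρ) {C : ℝ} (hz : 1 < z)
    (ht : ∀ N, tail h N * z ^ N ≤ C) (k : ℕ) : Summable fun t => h t * chooseWeight k t := by
  have hs := (summable_chooseWeight_mul_pow k (inv_nonneg.2 (by linarith))
    (inv_lt_one_of_one_lt₀ hz)).mul_left C
  refine Summable.of_nonneg_of_le
    (fun t => mul_nonneg (H.nonneg t) (chooseWeight_nonneg k t)) (fun t => ?_) hs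
  have h1 := (H.le_tail t).trans (tail_le_inv_pow hz ht t)
  calc h t * chooseWeight k t ≤ C * z⁻¹ ^ t * chooseWeight k t :=
        mul_le_mul_of_nonneg_right h1 (chooseWeight_nonneg k t)
    _ = _ := by ring

theorem tendsto_sum_chooseWeight_mul_tail (H : NearGeometric h a b ρ) {C : ℝ} (hz : 1 < z)
    (ht : ∀ N, tail h N * z ^ N ≤ C) (k : ℕ) :
    Tendsto (fun N => ∑ t ∈ Finset.range N, chooseWeight k t * tail h t) atTop
      (𝓝 (chooseMoment h (k + 1))) := by
  simp only [sum_chooseWeight_mul_tail]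
  rw [← add_zero (chooseMoment h (k + 1))]
  refine (H.summable_mul_chooseWeight hz ht (k + 1)).hasSum.tendsto_sum_nat.add ?_
  have hs := ((summable_chooseWeight_mul_pow (k + 1) (inv_nonneg.2 (by linarith))
    (inv_lt_one_of_one_lt₀ hz)).mul_left C).tendsto_atTop_zero
  have hV : ∀ N, 0 ≤ ∑ t ∈ Finset.range N, chooseWeight k t :=
    fun N => Finset.sum_nonneg fun t _ => chooseWeight_nonneg k t
  refine squeeze_zero (fun N => mul_nonneg (H.tail_nonneg N) (hV N)) (fun N => ?_) hs
  have h1 : ∑ t ∈ Finset.range N, chooseWeight k t ≤ chooseWeight (k + 1) N := by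
    rw [← sum_chooseWeight, Finset.sum_range_succ]
    linarith [chooseWeight_nonneg k N]
  have h2 := tail_le_inv_pow hz ht N
  calc _ ≤ C * z⁻¹ ^ N * chooseWeight (k + 1) N :=
        mul_le_mul h2 h1 (hV N) ((H.tail_nonneg N).trans h2)
    _ = _ := by ring

theorem chooseMoment_zero (H : NearGeometric h a b ρ) {C : ℝ} (hz : 1 < z)
    (ht : ∀ N, tail h N * z ^ N ≤ C) : chooseMoment h 0 = 1 := by
  have h1 := (H.summable_mul_chooseWeight hz ht 0).hasSum.tendsto_sum_nat
  have h2 : Tendsto (tail h) atTop (𝓝 0) := by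
    have h3 : Tendsto (fun N : ℕ => C * z⁻¹ ^ N) atTop (𝓝 0) := by
      simpa using (tendsto_pow_atTop_nhds_zero_of_lt_one (inv_nonneg.2 (by linarith))
        (inv_lt_one_of_one_lt₀ hz)).const_mul C
    exact squeeze_zero H.tail_nonneg (tail_le_inv_pow hz ht) h3
  refine tendsto_nhds_unique h1 ?_
  have h3 := h2.const_sub 1
  simpa [tail, chooseWeight] using h3

theorem chooseMoment_le (H : NearGeometric h a b ρ) {C : ℝ} (hz : 1 < z)
    (ht : ∀ N, tail h N * z ^ N ≤ C) (k : ℕ) :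
    chooseMoment h k ≤ a * chooseMoment h (k + 1) := by
  refine le_of_tendsto_of_tendsto'
    (H.summable_mul_chooseWeight hz ht k).hasSum.tendsto_sum_nat
    ((H.tendsto_sum_chooseWeight_mul_tail hz ht k).const_mul a) fun N => ?_
  rw [Finset.mul_sum]
  refine Finset.sum_le_sum fun t _ => ?_
  have := mul_le_mul_of_nonneg_right (H.le_rate_mul_tail t) (chooseWeight_nonneg k t)
  linarith

theorem le_chooseMoment (H : NearGeometric h a b ρ) {C : ℝ} (hz : 1 < z)
    (ht : ∀ N, tail h N * z ^ N ≤ C) (hρ : ρ < 1) (k : ℕ) :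
    a * chooseMoment h (k + 1)
      ≤ chooseMoment h k * (1 + b * ∑' t, chooseWeight k t * ρ ^ t)
        + b * ∑' t, chooseWeight k t * ρ ^ t := by
  refine le_of_tendsto_of_tendsto'
    ((H.tendsto_sum_chooseWeight_mul_tail hz ht k).const_mul a)
    (((H.summable_mul_chooseWeight hz ht k).hasSum.tendsto_sum_nat.mul_const _).add_const _)
    fun N => ?_
  refine H.sum_weight_mul_tail_le (chooseWeight_nonneg k) (chooseWeight_add_le k) (fun M => ?_) N
  exact (summable_chooseWeight_mul_pow k H.ratio_nonneg hρ).sum_le_tsum _ fun t _ =>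
    mul_nonneg (chooseWeight_nonneg k t) (pow_nonneg H.ratio_nonneg t)

end NearGeometric

/-! ### From binomial weights to powers -/

theorem pow_le_factorial_mul_chooseWeight (r t : ℕ) :
    (t : ℝ) ^ r ≤ r.factorial * chooseWeight r t := by
  induction r with
  | zero => simp [chooseWeight]
  | succ r ih =>
    have h := succ_mul_chooseWeight_succ r t
    have h0 := chooseWeight_nonneg r t
    rw [Nat.factorial_succ, pow_succ, Nat.cast_mul, Nat.cast_succ,
      mul_comm ((r : ℝ) + 1) _, mul_assoc, h]
    have h1 : (0 : ℝ) ≤ r.factorial * chooseWeight r t := by positivity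
    have h2 : (0 : ℝ) ≤ t := Nat.cast_nonneg t
    have h3 : (0 : ℝ) ≤ r := Nat.cast_nonneg r
    nlinarith [mul_le_mul_of_nonneg_right ih h2, mul_nonneg h1 h3]

/-- The left side is `(t+1)⋯(t+r+1)`, monic in `t`; its lower order terms are dominated by the
product with one factor fewer, which is negligible after scaling by the rate. -/
theorem exists_factorial_mul_chooseWeight_le (r : ℕ) : ∃ c : ℝ, ∀ t : ℕ,
    (r + 1).factorial * chooseWeight (r + 1) t
      ≤ (t : ℝ) ^ (r + 1) + c * (r.factorial * chooseWeight r t) := by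
  induction r with
  | zero => exact ⟨1, fun t => by simp [chooseWeight]⟩
  | succ r ih =>
    obtain ⟨c, hc⟩ := ih
    -- The new factor is `t + (r + 2)`: multiplying the old error by `t` costs `|c|`, and the
    -- constant part costs `r + 2`.
    refine ⟨|c| + (r + 2), fun t => ?_⟩
    have e1 : ((r + 1 + 1).factorial : ℝ) * chooseWeight (r + 1 + 1) t
        = ((t : ℝ) + r + 2) * ((r + 1).factorial * chooseWeight (r + 1) t) := by
      have h := succ_mul_chooseWeight_succ (r + 1) t
      rw [Nat.factorial_succ (r + 1)]
      push_cast at h ⊢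
      linear_combination ((r + 1).factorial : ℝ) * h
    have e2 : ((r + 1).factorial : ℝ) * chooseWeight (r + 1) t
        = ((t : ℝ) + r + 1) * (r.factorial * chooseWeight r t) := by
      have h := succ_mul_chooseWeight_succ r t
      rw [Nat.factorial_succ r]
      push_cast at h ⊢
      linear_combination (r.factorial : ℝ) * h
    have hx : (0 : ℝ) ≤ r.factorial * chooseWeight r t :=
      mul_nonneg (Nat.cast_nonneg _) (chooseWeight_nonneg r t)
    have h2 : (0 : ℝ) ≤ t := Nat.cast_nonneg t
    have h3 : (0 : ℝ) ≤ r := Nat.cast_nonneg r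
    have h4 := mul_le_mul_of_nonneg_left (hc t) h2
    have h5 : (t : ℝ) * (c * (r.factorial * chooseWeight r t))
        ≤ |c| * ((r + 1).factorial * chooseWeight (r + 1) t) := by
      rw [e2]
      calc (t : ℝ) * (c * (r.factorial * chooseWeight r t))
          ≤ (t : ℝ) * (|c| * (r.factorial * chooseWeight r t)) := by
            have := le_abs_self c
            gcongr
        _ = |c| * (t * (r.factorial * chooseWeight r t)) := by ring
        _ ≤ _ := by
            gcongr
            linarith
    rw [e1, pow_succ]
    linarith

theorem NearGeometric.summable_mul_pow {h : ℕ → ℝ} {a b ρ z C : ℝ} (H : NearGeometric h a b ρ)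
    (hz : 1 < z) (ht : ∀ N, tail h N * z ^ N ≤ C) (r : ℕ) :
    Summable fun t => h t * (t : ℝ) ^ r := by
  refine Summable.of_nonneg_of_le (fun t => mul_nonneg (H.nonneg t) (by positivity)) (fun t => ?_)
    ((H.summable_mul_chooseWeight hz ht r).mul_left (r.factorial : ℝ))
  have := mul_le_mul_of_nonneg_left (pow_le_factorial_mul_chooseWeight r t) (H.nonneg t)
  linarith

/-! ### Limits as the rate and the error tend to zero -/

section Limit

variable {h : ℕ → ℕ → ℝ} {a b : ℕ → ℝ} {ρ : ℝ}

theorem eventually_tail_mul_pow_le (H : ∀ᶠ n in atTop, NearGeometric (h n) (a n) (b n) ρ)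
    (hρ : ρ < 1) (ha : Tendsto a atTop (𝓝 0)) (hb : Tendsto b atTop (𝓝 0)) :
    ∀ᶠ n in atTop, ∀ N, tail (h n) N * (1 + a n / 2) ^ N ≤ 3 := by
  have h1 : Tendsto (fun n => (1 + a n / 2) * ρ) atTop (𝓝 ρ) := by
    simpa using ((ha.div_const 2).const_add 1).mul_const ρ
  have h2 : Tendsto (fun n => b n * (1 - (1 + a n / 2) * ρ)⁻¹) atTop (𝓝 0) := by
    simpa using hb.mul ((h1.const_sub 1).inv₀ (sub_pos.2 hρ).ne')
  filter_upwards [H, h1.eventually_lt_const hρ,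
    h2.eventually_le_const (by norm_num : (0 : ℝ) < 1 / 4)] with n hn h3 h4
  exact hn.tail_mul_pow_le h3 h4

theorem tendsto_rate_pow_mul_chooseMoment
    (H : ∀ᶠ n in atTop, NearGeometric (h n) (a n) (b n) ρ)
    (hρ : ρ < 1) (ha : Tendsto a atTop (𝓝 0)) (hb : Tendsto b atTop (𝓝 0)) (k : ℕ) :
    Tendsto (fun n => a n ^ k * chooseMoment (h n) k) atTop (𝓝 1) := by
  have HT := eventually_tail_mul_pow_le H hρ ha hb
  induction k with
  | zero =>
    refine tendsto_const_nhds.congr' ?_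
    filter_upwards [H, HT] with n hn hT
    rw [pow_zero, one_mul, hn.chooseMoment_zero (by linarith [hn.rate_pos]) hT]
  | succ k ih =>
    -- `W` does not depend on `n` because the ratio `ρ` is fixed, so `b n * W → 0`.
    set W := ∑' t, chooseWeight k t * ρ ^ t with hW
    have hup : Tendsto (fun n => a n ^ k * chooseMoment (h n) k * (1 + b n * W)
        + a n ^ k * (b n * W)) atTop (𝓝 1) := by
      have hbW : Tendsto (fun n => b n * W) atTop (𝓝 0) := by simpa using hb.mul_const W
      simpa using (ih.mul (hbW.const_add 1)).add ((ha.pow k).mul hbW)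
    refine tendsto_of_tendsto_of_tendsto_of_le_of_le' ih hup ?_ ?_
    · filter_upwards [H, HT] with n hn hT
      have := mul_le_mul_of_nonneg_left
        (hn.chooseMoment_le (by linarith [hn.rate_pos]) hT k) (pow_nonneg hn.rate_pos.le k)
      rw [pow_succ]
      linarith
    · filter_upwards [H, HT] with n hn hT
      have := mul_le_mul_of_nonneg_left
        (hn.le_chooseMoment (by linarith [hn.rate_pos]) hT hρ k) (pow_nonneg hn.rate_pos.le k)
      rw [pow_succ]
      linarith

theorem tendsto_rate_pow_mul_moment
    (H : ∀ᶠ n in atTop, NearGeometric (h n) (a n) (b n) ρ)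
    (hρ : ρ < 1) (ha : Tendsto a atTop (𝓝 0)) (hb : Tendsto b atTop (𝓝 0)) (r : ℕ) :
    Tendsto (fun n => a n ^ r * ∑' t : ℕ, h n t * (t : ℝ) ^ r) atTop (𝓝 (r.factorial : ℝ)) := by
  have HT := eventually_tail_mul_pow_le H hρ ha hb
  have hm := tendsto_rate_pow_mul_chooseMoment H hρ ha hb
  cases r with
  | zero => simpa [chooseMoment, chooseWeight] using hm 0
  | succ r =>
    obtain ⟨c, hc⟩ := exists_factorial_mul_chooseWeight_le r
    have hup : Tendsto (fun n => ((r + 1).factorial : ℝ)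
        * (a n ^ (r + 1) * chooseMoment (h n) (r + 1))) atTop (𝓝 ((r + 1).factorial : ℝ)) := by
      simpa using (hm (r + 1)).const_mul ((r + 1).factorial : ℝ)
    have hlow : Tendsto (fun n => ((r + 1).factorial : ℝ)
        * (a n ^ (r + 1) * chooseMoment (h n) (r + 1))
        - a n * (c * r.factorial * (a n ^ r * chooseMoment (h n) r))) atTop
        (𝓝 ((r + 1).factorial : ℝ)) := by
      simpa using hup.sub (ha.mul ((hm r).const_mul (c * r.factorial)))
    refine tendsto_of_tendsto_of_tendsto_of_le_of_le' hlow hup ?_ ?_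
    · filter_upwards [H, HT] with n hn hT
      have hz : 1 < 1 + a n / 2 := by linarith [hn.rate_pos]
      have s1 := (hn.summable_mul_chooseWeight hz hT (r + 1)).mul_left ((r + 1).factorial : ℝ)
      have s2 := (hn.summable_mul_chooseWeight hz hT r).mul_left (c * r.factorial)
      have h1 : ((r + 1).factorial : ℝ) * chooseMoment (h n) (r + 1)
          - c * r.factorial * chooseMoment (h n) r ≤ ∑' t : ℕ, h n t * (t : ℝ) ^ (r + 1) := by
        rw [chooseMoment, chooseMoment, ← tsum_mul_left, ← tsum_mul_left, ← s1.tsum_sub s2]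
        refine (s1.sub s2).tsum_le_tsum (fun t => ?_) (hn.summable_mul_pow hz hT (r + 1))
        have := mul_le_mul_of_nonneg_left (hc t) (hn.nonneg t)
        linarith
      have h2 := mul_le_mul_of_nonneg_left h1 (pow_nonneg hn.rate_pos.le (r + 1))
      refine le_trans (le_of_eq ?_) h2
      rw [pow_succ]
      ring
    · filter_upwards [H, HT] with n hn hT
      have hz : 1 < 1 + a n / 2 := by linarith [hn.rate_pos]
      have s1 := (hn.summable_mul_chooseWeight hz hT (r + 1)).mul_left ((r + 1).factorial : ℝ)
      have h1 : ∑' t : ℕ, h n t * (t : ℝ) ^ (r + 1)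
          ≤ ((r + 1).factorial : ℝ) * chooseMoment (h n) (r + 1) := by
        rw [chooseMoment, ← tsum_mul_left]
        refine (hn.summable_mul_pow hz hT (r + 1)).tsum_le_tsum (fun t => ?_) s1
        have := mul_le_mul_of_nonneg_left (pow_le_factorial_mul_chooseWeight (r + 1) t)
          (hn.nonneg t)
        linarith
      have h2 := mul_le_mul_of_nonneg_left h1 (pow_nonneg hn.rate_pos.le (r + 1))
      linarith

end Limit

/-! ### The completion time is nearly geometric -/

/-- Two bounds give their geometric mean. Coalescence alone has the growing prefactor `n`; giving up
half of its decay in `t` buys a prefactor `√(n q^n)` that vanishes. -/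
theorem le_sqrt_mul_sqrt_pow {x q c d : ℝ} (hx : 0 ≤ x) (hc : 0 ≤ c) (hq : 0 ≤ q) {t : ℕ}
    (h1 : x ≤ c) (h2 : x ≤ d * q ^ t) : x ≤ √(d * c) * √q ^ t := by
  have h3 : √q ^ t = √(q ^ t) := by
    rw [eq_comm, Real.sqrt_eq_iff_mul_self_eq (by positivity) (by positivity), ← mul_pow,
      Real.mul_self_sqrt hq]
  rw [h3, ← Real.sqrt_mul' _ (pow_nonneg hq t)]
  refine Real.le_sqrt_of_sq_le ?_
  calc x ^ 2 = x * x := sq x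
    _ ≤ c * (d * q ^ t) := mul_le_mul h1 h2 hx hc
    _ = d * c * q ^ t := by ring

theorem tail_firstHit (p : unitInterval) [NeZero n] (t : ℕ) :
    tail (firstHit p n) t = (driveLaw p n).real {ω | (t : ℕ∞) ≤ completionTime n ω} := by
  have hset : {ω : Drive n | (t : ℕ∞) ≤ completionTime n ω}
      = (⋃ s ∈ Finset.range t, {ω | completionTime n ω = s})ᶜ := by
    ext ω
    simp only [Set.mem_ofPred_eq, Set.mem_compl_iff, Set.mem_iUnion, Finset.mem_range, exists_prop,
      not_exists, not_and]
    refine ⟨fun h s hs he => ?_, fun h => ?_⟩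
    · rw [he] at h
      exact absurd (Nat.cast_le.1 h) (not_le.2 hs)
    · by_contra! hlt
      obtain ⟨s, hs⟩ := ENat.ne_top_iff_exists.1 hlt.ne_top
      rw [← hs] at hlt
      exact h s (Nat.cast_lt.1 hlt) hs.symm
  rw [hset, probReal_compl_eq_one_sub, measureReal_biUnion_finset]
  · rfl
  · intro s _ s' _ hne
    refine Set.disjoint_left.2 fun ω h1 h2 => hne ?_
    exact_mod_cast h1.symm.trans h2
  · exact fun s _ => measurableSet_completionTime s
  · exact Finset.measurableSet_biUnion _ fun s _ => measurableSet_completionTime s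

theorem nearGeometric_firstHit (p : unitInterval) [NeZero n] {ν : Fin (n + 1) → ℝ}
    (h : IsStationaryLaw (1 - (p : ℝ)) n ν) (hpos : 0 < ν (Fin.last n)) :
    NearGeometric (firstHit p n) (ν (Fin.last n)) √(n * (1 - (p : ℝ)) ^ n) √(1 - (p : ℝ)) := by
  have hq : 0 ≤ 1 - (p : ℝ) := sub_nonneg.2 p.2.2
  have hdiff := fun t => (le_abs_self _).trans
    (abs_countTransition_pow_sub_le (n := n) p t (Fin.last n) (Fin.last n))
  refine nearGeometric_of_renewal
    (u := fun t => (countTransition (1 - (p : ℝ)) n ^ t) 0 (Fin.last n))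
    (r := fun t => (countTransition (1 - (p : ℝ)) n ^ t) (Fin.last n) (Fin.last n))
    (fun t => measureReal_nonneg) (fun t => ?_) hpos (Real.sqrt_nonneg _) (Real.sqrt_nonneg _)
    (by simp) (renewal_equation p) h.le_last (fun t => ?_) h.last_le (fun t ht => ?_)
  · rw [tail_firstHit]
    exact measureReal_nonneg
  · rw [← sub_le_iff_le_add']
    refine le_sqrt_mul_sqrt_pow (sub_nonneg.2 (h.le_last t)) (pow_nonneg hq n) hq ?_ ?_
    · linarith [h.last_le_pow, countTransition_pow_nonneg p t 0 (Fin.last n)]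
    · linarith [hdiff t, h.last_le t]
  · rw [← sub_le_iff_le_add']
    refine le_sqrt_mul_sqrt_pow (sub_nonneg.2 (h.last_le t)) (pow_nonneg hq n) hq ?_ ?_
    · linarith [countTransition_pow_last_le p ht (Fin.last n)]
    · linarith [hdiff t, h.le_last t]

/-! ### Measurability, integrals and tails of the completion time -/

theorem measurable_completionTime_toNat :
    Measurable fun ω : Drive n => (completionTime n ω).toNat := by
  have htop : MeasurableSet {ω : Drive n | completionTime n ω = ⊤} := by
    have : {ω : Drive n | completionTime n ω = ⊤} = ⋂ t : ℕ, {ω | completionTime n ω = t}ᶜ := by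
      ext ω
      simp only [Set.mem_ofPred_eq, Set.mem_iInter, Set.mem_compl_iff]
      exact ⟨fun h t => by simp [h], fun h => by_contra fun h' =>
        let ⟨s, hs⟩ := ENat.ne_top_iff_exists.1 h'; h s hs.symm⟩
    rw [this]
    exact MeasurableSet.iInter fun t => (measurableSet_completionTime t).compl
  refine measurable_to_countable' fun t => ?_
  -- Since `⊤.toNat = 0`, the fibre over `0` also contains the event of no completion.
  have : (fun ω : Drive n => (completionTime n ω).toNat) ⁻¹' {t}
      = {ω | completionTime n ω = t} ∪ ({ω | completionTime n ω = ⊤} ∩ {_ω | t = 0}) := by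
    ext ω
    simp only [Set.mem_preimage, Set.mem_singleton_iff, Set.mem_union, Set.mem_inter_iff,
      Set.mem_ofPred_eq]
    rcases eq_or_ne (completionTime n ω) ⊤ with h | h
    · simp [h, eq_comm]
    · obtain ⟨s, hs⟩ := ENat.ne_top_iff_exists.1 h
      simp [← hs]
  rw [this]
  exact (measurableSet_completionTime t).union (htop.inter (MeasurableSet.const _))

theorem ae_completionTime_ne_top (p : unitInterval) [NeZero n] {z C : ℝ} (hz : 1 < z)
    (ht : ∀ N, tail (firstHit p n) N * z ^ N ≤ C) :
    ∀ᵐ ω ∂(driveLaw p n), completionTime n ω ≠ ⊤ := by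
  rw [ae_iff]
  simp only [ne_eq, not_not]
  rw [← measureReal_eq_zero_iff]
  refine le_antisymm ?_ measureReal_nonneg
  have h3 : Tendsto (fun N : ℕ => C * z⁻¹ ^ N) atTop (𝓝 0) := by
    simpa using (tendsto_pow_atTop_nhds_zero_of_lt_one (inv_nonneg.2 (by linarith))
      (inv_lt_one_of_one_lt₀ hz)).const_mul C
  refine ge_of_tendsto' h3 fun N => ?_
  refine le_trans ?_ (NearGeometric.tail_le_inv_pow hz ht N)
  rw [tail_firstHit]
  refine measureReal_mono fun ω hω => ?_
  rw [Set.mem_ofPred_eq] at hω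
  simp [hω]

theorem map_toNat_real_singleton (p : unitInterval) [NeZero n]
    (hfin : ∀ᵐ ω ∂(driveLaw p n), completionTime n ω ≠ ⊤) (t : ℕ) :
    ((driveLaw p n).map fun ω => (completionTime n ω).toNat).real {t} = firstHit p n t := by
  rw [map_measureReal_apply measurable_completionTime_toNat (measurableSet_singleton t), firstHit]
  refine measureReal_congr ?_
  filter_upwards [hfin] with ω hω
  obtain ⟨s, hs⟩ := ENat.ne_top_iff_exists.1 hω
  refine propext ?_
  change (completionTime n ω).toNat = t ↔ completionTime n ω = t
  simp [← hs]

theorem integrable_completionTimeReal_pow (p : unitInterval) [NeZero n]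
    (hfin : ∀ᵐ ω ∂(driveLaw p n), completionTime n ω ≠ ⊤) {r : ℕ}
    (hs : Summable fun t : ℕ => firstHit p n t * (t : ℝ) ^ r) :
    Integrable (fun ω => completionTimeReal n ω ^ r) (driveLaw p n) ∧
      ∫ ω, completionTimeReal n ω ^ r ∂(driveLaw p n) = ∑' t : ℕ, firstHit p n t * (t : ℝ) ^ r := by
  set μ := (driveLaw p n).map fun ω => (completionTime n ω).toNat with hμ
  have hprob : IsProbabilityMeasure μ :=
    Measure.isProbabilityMeasure_map measurable_completionTime_toNat.aemeasurable
  have hint : Integrable (fun t : ℕ => (t : ℝ) ^ r) μ := by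
    rw [← Measure.sum_smul_dirac μ, integrable_sum_dirac_iff (fun t => measure_ne_top μ _)]
    refine hs.congr fun t => ?_
    rw [← measureReal_def, hμ, map_toNat_real_singleton p hfin,
      Real.norm_of_nonneg (by positivity)]
  constructor
  · exact (integrable_map_measure hint.aestronglyMeasurable
      measurable_completionTime_toNat.aemeasurable).1 hint
  · have h1 := integral_map (μ := driveLaw p n) measurable_completionTime_toNat.aemeasurable
      hint.aestronglyMeasurable
    rw [integral_countable hint] at h1
    simp only [hμ, map_toNat_real_singleton p hfin, smul_eq_mul] at h1
    exact h1.symm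

theorem memLp_completionTimeReal (p : unitInterval) [NeZero n]
    (hfin : ∀ᵐ ω ∂(driveLaw p n), completionTime n ω ≠ ⊤) (r : ℕ)
    (hs : Summable fun t : ℕ => firstHit p n t * (t : ℝ) ^ r) :
    MemLp (completionTimeReal n) (r : ENNReal) (driveLaw p n) := by
  have hm : AEStronglyMeasurable (completionTimeReal n) (driveLaw p n) :=
    (measurable_from_nat.comp measurable_completionTime_toNat).aestronglyMeasurable
  rcases eq_or_ne r 0 with rfl | hr
  · simpa using hm
  · rw [← integrable_norm_rpow_iff hm (by exact_mod_cast hr) (by simp)]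
    refine (integrable_completionTimeReal_pow p hfin hs).1.congr (Eventually.of_forall fun ω => ?_)
    have : 0 ≤ completionTimeReal n ω := Nat.cast_nonneg _
    simp [abs_of_nonneg this]

/-- The event forces `T ≥ N` with `N = ⌊x / m⌋ + 1`, also when `T = ⊤`. There `(1 + a/2)^N ≥ exp (N
a / 4) ≥ exp (x / 4)`, because `N a ≥ N m ≥ x`. -/
theorem driveLaw_real_lt_mul_completionTime_le (p : unitInterval) [NeZero n] {a m x : ℝ}
    (ha : a ≤ 1) (hm : 0 < m) (hma : m ≤ a) (hx : 0 ≤ x)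
    (ht : ∀ N, tail (firstHit p n) N * (1 + a / 2) ^ N ≤ 3) :
    (driveLaw p n).real {ω | ENNReal.ofReal x <
        ENNReal.ofReal m * ((completionTime n ω : ℕ∞) : ENNReal)}
      ≤ 3 * Real.exp (-(1 / 4 * x)) := by
  have ha0 : 0 < a := hm.trans_le hma
  set N := ⌊x / m⌋₊ + 1 with hN
  have hxN : x / m ≤ N := by
    rw [hN]; push_cast; exact (Nat.lt_floor_add_one _).le
  have hlog : a / 4 ≤ Real.log (1 + a / 2) := by
    refine le_trans ?_ (Real.le_log_one_add_of_nonneg (by positivity))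
    rw [le_div_iff₀ (by positivity)]
    nlinarith
  have hexp : Real.exp (1 / 4 * x) ≤ (1 + a / 2) ^ N := by
    rw [← Real.exp_log (show (0 : ℝ) < 1 + a / 2 by positivity), ← Real.exp_nat_mul]
    refine Real.exp_le_exp.2 ?_
    have h1 : x ≤ N * m := (div_le_iff₀ hm).1 hxN
    have h2 : (N : ℝ) * m ≤ N * a := by gcongr
    have h3 : (N : ℝ) * (a / 4) ≤ N * Real.log (1 + a / 2) := by gcongr
    linarith
  have h1 : (driveLaw p n).real {ω | ENNReal.ofReal x <
      ENNReal.ofReal m * ((completionTime n ω : ℕ∞) : ENNReal)} ≤ tail (firstHit p n) N := by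
    rw [tail_firstHit]
    refine measureReal_mono fun ω hω => ?_
    rw [Set.mem_ofPred_eq] at hω ⊢
    rcases eq_or_ne (completionTime n ω) ⊤ with h | h
    · simp [h]
    · obtain ⟨s, hs⟩ := ENat.ne_top_iff_exists.1 h
      rw [← hs] at hω ⊢
      rw [ENat.toENNReal_coe, ← ENNReal.ofReal_natCast, ← ENNReal.ofReal_mul hm.le] at hω
      have h2 : x < m * s := (ENNReal.ofReal_lt_ofReal_iff_of_nonneg hx).1 hω
      have h3 : x / m < s := by rwa [div_lt_iff₀' hm]
      exact_mod_cast (Nat.floor_lt (by positivity)).2 h3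
  refine h1.trans ?_
  rw [Real.exp_neg, ← div_eq_mul_inv, le_div_iff₀ (Real.exp_pos _)]
  have h0 : 0 ≤ tail (firstHit p n) N := by rw [tail_firstHit]; exact measureReal_nonneg
  exact (mul_le_mul_of_nonneg_left hexp h0).trans (ht N)

end CarelessCollector

end

open CarelessCollector in
theorem mainTheorem4 (p : unitInterval) (hp0 : 0 < p) (hp1 : p < 1)
    (q : ℝ) (hq : q = 1 - (p : ℝ)) :
    ∃ ν : (n : ℕ) → Fin (n + 1) → ℝ,
      -- for `n ≥ 1`, `ν n` is the unique stationary law of the count chain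
      (∀ n : ℕ, 1 ≤ n → CarelessCollector.IsStationaryLaw q n (ν n) ∧
        ∀ ν' : Fin (n + 1) → ℝ, CarelessCollector.IsStationaryLaw q n ν' → ν' = ν n) ∧
      -- uniform exponential tails of `μ_n T_{n,p}`
      (∃ C : ℝ, 0 < C ∧ ∃ c : ℝ, 0 < c ∧ ∀ᶠ n : ℕ in atTop, ∀ x : ℝ, 0 ≤ x →
        (CarelessCollector.driveLaw p n).real
            {ω | ENNReal.ofReal x <
              ENNReal.ofReal (CarelessCollector.entryFlux q n (ν n)) *
                ((CarelessCollector.completionTime n ω : ℕ∞) : ENNReal)}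
          ≤ C * Real.exp (-(c * x))) ∧
      -- `T_{n,p}` is almost surely finite, with finite moments
      (∀ᶠ n : ℕ in atTop,
        (∀ᵐ ω ∂(CarelessCollector.driveLaw p n), CarelessCollector.completionTime n ω ≠ ⊤) ∧
        ∀ r : ℕ, MemLp (CarelessCollector.completionTimeReal n) (r : ENNReal)
          (CarelessCollector.driveLaw p n)) ∧
      -- convergence of all moments
      (∀ r : ℕ, 1 ≤ r → Tendsto
        (fun n : ℕ => ∫ ω, (CarelessCollector.entryFlux q n (ν n) *
            CarelessCollector.completionTimeReal n ω) ^ r ∂(CarelessCollector.driveLaw p n))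
        atTop (𝓝 (r.factorial : ℝ))) ∧
      -- mean and variance in terms of the flux
      (fun n : ℕ => ∫ ω, CarelessCollector.completionTimeReal n ω
          ∂(CarelessCollector.driveLaw p n))
        ~[atTop] (fun n : ℕ => 1 / CarelessCollector.entryFlux q n (ν n)) ∧
      (fun n : ℕ => variance (CarelessCollector.completionTimeReal n)
          (CarelessCollector.driveLaw p n))
        ~[atTop] (fun n : ℕ => 1 / CarelessCollector.entryFlux q n (ν n) ^ 2) ∧
      -- the sharp asymptotics of the flux
      (fun n : ℕ => CarelessCollector.entryFlux q n (ν n))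
        ~[atTop] (fun n : ℕ => 1 / CarelessCollector.qPoch q *
          ((n.factorial : ℝ) / (n : ℝ) ^ n) * q ^ (n * (n + 1) / 2)) ∧
      -- explicit mean and variance
      (fun n : ℕ => ∫ ω, CarelessCollector.completionTimeReal n ω
          ∂(CarelessCollector.driveLaw p n))
        ~[atTop] (fun n : ℕ => CarelessCollector.qPoch q *
          ((n : ℝ) ^ n / (n.factorial : ℝ)) * (q ^ (n * (n + 1) / 2))⁻¹) ∧
      (fun n : ℕ => variance (CarelessCollector.completionTimeReal n)
          (CarelessCollector.driveLaw p n))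
        ~[atTop] (fun n : ℕ => CarelessCollector.qPoch q ^ 2 *
          ((n : ℝ) ^ n / (n.factorial : ℝ)) ^ 2 * (q ^ (n * (n + 1)))⁻¹) := by
  have hp0' : (0 : ℝ) < p := hp0
  have hp1' : (p : ℝ) < 1 := hp1
  have hq0 : 0 < q := by rw [hq]; linarith
  have hq1 : q < 1 := by rw [hq]; linarith
  have hex : ∀ n : ℕ, ∃ ν : Fin (n + 1) → ℝ, 1 ≤ n → IsStationaryLaw q n ν := by
    intro n
    rcases Nat.eq_zero_or_pos n with h | h
    · exact ⟨0, fun h' => by omega⟩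
    · have : NeZero n := ⟨h.ne'⟩
      obtain ⟨ν, hν⟩ := exists_isStationaryLaw (n := n) hp0
      exact ⟨ν, fun _ => hq ▸ hν⟩
  choose ν hν using hex
  have hqpos := qPoch_ne_zero hq0.le hq1
  set a : ℕ → ℝ := fun n => ν n (Fin.last n) with ha_def
  set e : ℕ → ℝ := fun n => (n.factorial : ℝ) / (n : ℝ) ^ n * q ^ (n * (n + 1) / 2) with he_def
  set D : ℕ → ℝ := fun n => stationaryDenom q n n with hD_def
  set m : ℕ → ℝ := fun n => entryFlux q n (ν n) with hm_def
  have hqn : Tendsto (fun n : ℕ => q ^ n) atTop (𝓝 0) :=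
    tendsto_pow_atTop_nhds_zero_of_lt_one hq0.le hq1
  have hae : ∀ n, 1 ≤ n → a n = e n / D n := fun n hn =>
    have : NeZero n := ⟨by omega⟩
    (hν n hn).last_eq hq0.le hq1
  have hme : ∀ n, 1 ≤ n → m n = a n * (1 - q ^ n) := fun n hn =>
    have : NeZero n := ⟨by omega⟩
    (hν n hn).entryFlux_eq
  have he_pos : ∀ n, 1 ≤ n → 0 < e n := fun n hn => by
    have : 0 < n := hn
    positivity
  have hD_pos : ∀ n, 0 < D n := fun n =>
    Finset.prod_pos fun i _ => one_sub_pow_mul_pos hq0.le hq1 n i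
  have ha_pos : ∀ n, 1 ≤ n → 0 < a n := fun n hn => by
    rw [hae n hn]; exact div_pos (he_pos n hn) (hD_pos n)
  have ha_le : ∀ n, 1 ≤ n → a n ≤ q ^ n := fun n hn => by
    have : NeZero n := ⟨by omega⟩
    subst hq
    exact (hν n hn).last_le_pow
  have hm_pos : ∀ n, 1 ≤ n → 0 < m n := fun n hn => by
    rw [hme n hn]
    exact mul_pos (ha_pos n hn) (sub_pos.2 (pow_lt_one₀ hq0.le hq1 (by omega)))
  have ha0 : Tendsto a atTop (𝓝 0) := squeeze_zero'
    (eventually_atTop.2 ⟨1, fun n hn => (ha_pos n hn).le⟩) (eventually_atTop.2 ⟨1, ha_le⟩) hqn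
  have hb0 : Tendsto (fun n : ℕ => √(n * q ^ n)) atTop (𝓝 0) := by
    have := tendsto_self_mul_const_pow_of_lt_one hq0.le hq1
    simpa using this.sqrt
  have hρ : √q < 1 := by rw [Real.sqrt_lt' one_pos]; linarith
  have H : ∀ᶠ n : ℕ in atTop, NearGeometric (firstHit p n) (a n) √(n * q ^ n) √q := by
    refine eventually_atTop.2 ⟨1, fun n hn => ?_⟩
    have : NeZero n := ⟨by omega⟩
    subst hq
    exact nearGeometric_firstHit p (hν n hn) (ha_pos n hn)
  have HT := eventually_tail_mul_pow_le H hρ ha0 hb0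
  have hmom := tendsto_rate_pow_mul_moment H hρ ha0 hb0
  have Hgood : ∀ᶠ n : ℕ in atTop, (∀ᵐ ω ∂(driveLaw p n), completionTime n ω ≠ ⊤) ∧
      ∀ r : ℕ, Summable fun t : ℕ => firstHit p n t * (t : ℝ) ^ r := by
    filter_upwards [H, HT, eventually_ge_atTop 1] with n h1 h2 hn
    have : NeZero n := ⟨by omega⟩
    have hz : 1 < 1 + a n / 2 := by linarith [h1.rate_pos]
    exact ⟨ae_completionTime_ne_top p hz h2, h1.summable_mul_pow hz h2⟩
  have Hint : ∀ r : ℕ, ∀ᶠ n : ℕ in atTop,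
      ∑' t : ℕ, firstHit p n t * (t : ℝ) ^ r
        = ∫ ω, completionTimeReal n ω ^ r ∂(driveLaw p n) := by
    intro r
    filter_upwards [Hgood, eventually_ge_atTop 1] with n h1 hn
    have : NeZero n := ⟨by omega⟩
    exact (integrable_completionTimeReal_pow p h1.1 (h1.2 r)).2.symm
  have hmomE : ∀ r : ℕ, Tendsto
      (fun n => m n ^ r * ∫ ω, completionTimeReal n ω ^ r ∂(driveLaw p n)) atTop
      (𝓝 (r.factorial : ℝ)) := by
    intro r
    -- Passing from the rate `a n` to the flux `m n = a n * (1 - q ^ n)` does not change the limit.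
    have h1 : Tendsto (fun n : ℕ => (1 - q ^ n) ^ r) atTop (𝓝 1) := by
      simpa using (hqn.const_sub 1).pow r
    have h2 := h1.mul (hmom r)
    rw [one_mul] at h2
    refine h2.congr' ?_
    filter_upwards [Hint r, eventually_ge_atTop 1] with n h3 hn
    rw [h3, hme n hn, mul_pow]
    ring
  have hmean : (fun n : ℕ => ∫ ω, completionTimeReal n ω ∂(driveLaw p n))
      ~[atTop] (fun n : ℕ => 1 / m n) := by
    refine isEquivalent_of_tendsto_one ?_
    refine (by simpa using hmomE 1 : Tendsto _ _ (𝓝 (1 : ℝ))).congr fun n => ?_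
    rw [Pi.div_apply, div_div_eq_mul_div, div_one, mul_comm]
  have hvar : (fun n : ℕ => variance (completionTimeReal n) (driveLaw p n))
      ~[atTop] (fun n : ℕ => 1 / m n ^ 2) := by
    refine isEquivalent_of_tendsto_one ?_
    -- The scaled variance tends to `2! - (1!)^2 = 1`, as for an exponential variable.
    have h1 := (hmomE 2).sub ((hmomE 1).pow 2)
    have h2 : ((Nat.factorial 2 : ℕ) : ℝ) - ((Nat.factorial 1 : ℕ) : ℝ) ^ 2 = 1 := by
      norm_num [Nat.factorial]
    rw [h2] at h1
    refine h1.congr' ?_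
    filter_upwards [Hgood, eventually_ge_atTop 1] with n h3 hn
    have : NeZero n := ⟨by omega⟩
    rw [Pi.div_apply, div_div_eq_mul_div, div_one,
      variance_eq_sub (by exact_mod_cast memLp_completionTimeReal p h3.1 2 (h3.2 2))]
    simp only [pow_one, Pi.pow_apply]
    ring
  have hflux : m ~[atTop] (fun n : ℕ => 1 / qPoch q *
      ((n.factorial : ℝ) / (n : ℝ) ^ n) * q ^ (n * (n + 1) / 2)) := by
    refine isEquivalent_of_tendsto_one ?_
    -- This is the exact ratio of the flux to its claimed asymptotic form, for `n ≥ 1`.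
    have h1 : Tendsto (fun n : ℕ => qPoch q / D n * (1 - q ^ n)) atTop (𝓝 1) := by
      have := ((tendsto_const_nhds (x := qPoch q)).div
        (tendsto_stationaryDenom hq0.le hq1) hqpos).mul (hqn.const_sub 1)
      simpa [hqpos] using this
    refine h1.congr' ?_
    filter_upwards [eventually_ge_atTop 1] with n hn
    have e1 : 1 / qPoch q * ((n.factorial : ℝ) / (n : ℝ) ^ n) * q ^ (n * (n + 1) / 2)
        = e n / qPoch q := by
      rw [he_def]; ring
    have := (he_pos n hn).ne'
    have := (hD_pos n).ne'
    rw [Pi.div_apply, e1, hme n hn, hae n hn]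
    field_simp
  refine ⟨ν, fun n hn => ⟨hν n hn, fun ν' h' => ?_⟩, ⟨3, by norm_num, 1 / 4, by norm_num, ?_⟩, ?_,
    fun r _ => ?_, hmean, hvar, hflux, ?_, ?_⟩
  · have : NeZero n := ⟨by omega⟩
    subst hq
    exact (hν n hn).unique hp0 h'
  · filter_upwards [HT, eventually_ge_atTop 1] with n h1 hn x hx
    have : NeZero n := ⟨by omega⟩
    have hqn1 : q ^ n ≤ 1 := pow_le_one₀ hq0.le hq1.le
    refine driveLaw_real_lt_mul_completionTime_le p ((ha_le n hn).trans hqn1) (hm_pos n hn) ?_ hx h1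
    change m n ≤ a n
    rw [hme n hn]
    nlinarith [ha_pos n hn, pow_pos hq0 n]
  · filter_upwards [Hgood, eventually_ge_atTop 1] with n h1 hn
    have : NeZero n := ⟨by omega⟩
    exact ⟨h1.1, fun r => memLp_completionTimeReal p h1.1 r (h1.2 r)⟩
  · refine (hmomE r).congr fun n => ?_
    rw [← integral_const_mul]
    simp only [mul_pow, hm_def]
  · refine hmean.trans ((hflux.inv).congr_left ?_ |>.congr_right ?_)
    · exact Eventually.of_forall fun n => by simp
    · refine Eventually.of_forall fun n => ?_
      simp only [Pi.inv_apply, mul_inv, inv_div, one_div, inv_inv]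
  · refine hvar.trans (((hflux.pow 2).inv).congr_left ?_ |>.congr_right ?_)
    · exact Eventually.of_forall fun n => by simp
    · refine Eventually.of_forall fun n => ?_
      -- The division in the exponent is exact because `n * (n + 1)` is even.
      have h2 : (q ^ (n * (n + 1) / 2)) ^ 2 = q ^ (n * (n + 1)) := by
        rw [← pow_mul, Nat.div_mul_cancel (Nat.even_mul_succ_self n).two_dvd]
      simp only [Pi.inv_apply, Pi.pow_apply, mul_pow, mul_inv, h2, ← inv_pow, inv_div, one_div,
        inv_inv]
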